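/- Let $n\ge 1$, let $F_q$ be a finite field with $q$ elements, and let $V=F_q^{2n}$ carry the non-degenerate alternating form with symplectic basis $u_1,\dots,u_n,v_1,\dots,v_n$, i.e. $\langle u_i,v_j\rangle=\delta_{ij}$, $\langle u_i,u_j\rangle=\langle v_i,v_j\rangle=0$. Put $M=\mathrm{span}\{u_i\}$, $N=\mathrm{span}\{v_i\}$, $\mathrm{Sp}=\mathrm{Sp}(V)$. Let $\mathrm{Sp}_M$ be the global and $\mathrm{Sp}^M$ the pointwise stabilizer of $M$, and $\mathrm{Sp}_{M,N}$ the subgroup preserving both $M$ and $N$. Let $T\subseteq\mathrm{Sp}_{M,N}$ consist of the elements with matrix $\mathrm{diag}(A,{}^tA^{-1})$, $A$ upper unitriangular; let $U=T\ltimes \mathrm{Sp}^M$, let $H\subseteq \mathrm{Sp}_{M,N}$ consist of the elements having all $u_i,v_j$ as eigenvectors, and $B=U\rtimes H$. For a permutation $\sigma$ of $\{1,\dots,n\}$ let $\sigma$ also denote the element $u_i\mapsto u_{\sigma(i)}$, $v_i\mapsto v_{\sigma(i)}$ of $\mathrm{Sp}$; let $w_i$ ($1\le i<n$) be the element of the transposition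 $(i,i+1)$, and let $c_j$ be the element with $u_j\mapsto v_j$, $v_j\mapsto -u_j$ fixing the other basis vectors. Let $W_2=\langle w_1,\dots,w_{n-1},c_1,\dots,c_n\rangle$, let $W=W_2H/H$ be the Weyl group, with representatives $n_w\in W_2$, and let $\ell$ be the length function of $W$ for the generators $w_1H,\dots,w_{n-1}H,c_nH$. Let $F$ be a field of characteristic $l$ and $\lambda:(F_q,+)\to F^*$ a non-trivial homomorphism. In the group algebra $F\mathrm{Sp}$ put $e=\bigl(\sum_{w\in W}(-1)^{\ell(w)}n_w\bigr)\sum_{b\in B}b$, and let $I=F\mathrm{Sp}\cdot e$ be the Steinberg module. For $v\in V$ and $g\in \mathrm{Sp}$ put $\chi_v(g)=\lambda(\langle gv,v\rangle)$; for $\alpha\in F_q^*$ put $e_{\chi_{\alpha v_n}}=\sum_{u\in U}\chi_{\alpha v_n}(u)^{-1}ue$. For $1\le i\le n$ let $w(i)$ be the element of the cycle $n\mapsto i\mapsto i+1\mapsto\cdots\mapsto n-1\mapsto n$, let $I_{\alpha,i}$ be the $FU$-submodule of $I$ generated by $w(i)e_{\chi_{\alpha v_n}}$, let $I_i=\sum_{\alpha\in\mathcal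 T_q}I_{\alpha,i}$, where $\mathcal T_q$ is a transversal for the action of $\{\pm1\}$ on $F_q^*$, and let $L=\sum_{i=1}^n I_i\subseteq I$. Let $X$ be the $F$-space with basis $(E_v)_{v\in N}$, on which $\mathrm{Sp}_M=\mathrm{Sp}^M\rtimes \mathrm{Sp}_{M,N}$ acts by $sa\,E_v=\lambda(\langle sav,av\rangle)E_{av}$ for $s\in \mathrm{Sp}^M$, $a\in \mathrm{Sp}_{M,N}$. Let $X^+_\lambda$ be the $\mathrm{Sp}_M$-submodule spanned by the $E_v^+$, $0\ne v\in N$, where $E_v^+=E_v+E_{-v}$ if $q$ is odd and $E_v^+=E_v$ if $q$ is even. Theorem. Suppose $l$ divides $q+1$. Then $L$ is an $\mathrm{Sp}_M$-submodule of $I$, it is absolutely irreducible (irreducible over every extension field of $F$), and it is isomorphic to $X^+_\lambda$ as an $F\mathrm{Sp}_M$-module. -/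

import Mathlib

namespace SymplecticSteinberg

open Matrix
open scoped MonoidAlgebra

noncomputable section

universe u v w

/-! ### General facts: finite groups and absolute irreducibility -/

/-- A subset of a finite group that contains `1` and is closed under products is a subgroup. -/
def finiteSubgroup {G : Type u} [Group G] [Finite G] (S : Set G) (one_mem : (1 : G) ∈ S)
    (mul_mem : ∀ a b, a ∈ S → b ∈ S → a * b ∈ S) : Subgroup G where
  carrier := S
  one_mem' := one_mem
  mul_mem' := fun {a b} ha hb => mul_mem a b ha hb
  inv_mem' := by
    intro x hx
    have hpow : ∀ k : ℕ, x ^ k ∈ S := by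
      intro k
      induction k with
      | zero => simpa using one_mem
      | succ k ih => rw [pow_succ]; exact mul_mem _ _ ih hx
    have h : x⁻¹ = x ^ (orderOf x - 1) := by
      rw [inv_eq_iff_mul_eq_one, ← pow_succ', Nat.sub_add_cancel (orderOf_pos x),
        pow_orderOf_eq_one]
    rw [h]
    exact hpow _

/-- Extension of scalars of a representation `ρ : G → GL(V)` from `F` to `E`, acting on
`E ⊗ V`. -/
def extendScalars {F : Type u} {G : Type v} {V : Type w} [Field F] [Group G] [AddCommGroup V]
    [Module F V] (ρ : Representation F G V) (E : Type u) [Field E] [Algebra F E] :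
    Representation E G (TensorProduct F E V) :=
  (Module.End.baseChangeHom F E V : Module.End F V →* Module.End E (TensorProduct F E V)).comp ρ

/-- `ρ` is absolutely irreducible: it remains irreducible over every field extension. -/
def IsAbsolutelyIrreducible {F : Type u} {G : Type v} {V : Type w} [Field F] [Group G]
    [AddCommGroup V] [Module F V] (ρ : Representation F G V) : Prop :=
  ∀ (E : Type u) [Field E] [Algebra F E], (extendScalars ρ E).IsIrreducible

/-! ### The symplectic space and the symplectic group -/

/-- The space `V = K^{2n}`; the coordinates `Sum.inl i`, `Sum.inr i` belong to `u_i`, `v_i`. -/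
abbrev V (n : ℕ) (K : Type u) : Type u := Fin n ⊕ Fin n → K

/-- The group `Sp_{2n}(K)`, acting on `V` by `g *ᵥ x`. -/
abbrev Sp (n : ℕ) (K : Type u) [Field K] : Type u := Matrix.symplecticGroup (Fin n) K

variable {n : ℕ} {K : Type u} [Field K]

/-- The alternating form with `⟨u_i, v_j⟩ = δ_ij` and `⟨u_i, u_j⟩ = ⟨v_i, v_j⟩ = 0`. -/
def form (x y : V n K) : K :=
  ∑ i : Fin n, (x (Sum.inl i) * y (Sum.inr i) - x (Sum.inr i) * y (Sum.inl i))

/-- The action of `Sp` on `V`. -/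
def act (g : Sp n K) (x : V n K) : V n K := (g : Matrix (Fin n ⊕ Fin n) (Fin n ⊕ Fin n) K) *ᵥ x

/-- The basis vector `u_i`. -/
def uVec (i : Fin n) : V n K := Pi.single (Sum.inl i) 1

/-- The vector `∑ x_i v_i` of `N` with coordinates `x`. -/
def ofN (x : Fin n → K) : V n K := Sum.elim 0 x

/-- The coordinates of the projection to `N` along `M`. -/
def projN (x : V n K) : Fin n → K := fun i => x (Sum.inr i)

/-- The basis vector `v_i`. -/
def vVec (i : Fin n) : V n K := Pi.single (Sum.inr i) 1

variable (n K) in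
/-- `M = span {u_1, …, u_n}`. -/
def M : Submodule K (V n K) := Submodule.span K (Set.range uVec)

variable (n K) in
/-- `N = span {v_1, …, v_n}`. -/
def N : Submodule K (V n K) := Submodule.span K (Set.range vVec)

lemma form_eq (x y : V n K) : form x y = -(x ⬝ᵥ Matrix.J (Fin n) K *ᵥ y) := by
  simp [form, Matrix.J, dotProduct, Fintype.sum_sum_type, Matrix.mulVec, Matrix.fromBlocks,
    Matrix.one_apply, Finset.sum_sub_distrib]
  ring

lemma form_act (g : Sp n K) (x y : V n K) : form (act g x) (act g y) = form x y := by
  have h := SymplecticGroup.mem_iff'.1 g.2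
  rw [form_eq, form_eq, act, act, Matrix.dotProduct_mulVec, Matrix.vecMul_mulVec,
    ← Matrix.dotProduct_mulVec, Matrix.mulVec_mulVec, h]

/-- The matrices in `Sp` are exactly those that preserve the form. -/
lemma mem_Sp_iff (g : Matrix (Fin n ⊕ Fin n) (Fin n ⊕ Fin n) K) :
    g ∈ Matrix.symplecticGroup (Fin n) K ↔ ∀ x y : V n K, form (g *ᵥ x) (g *ᵥ y) = form x y := by
  refine ⟨fun h x y => form_act ⟨g, h⟩ x y, fun h => SymplecticGroup.mem_iff'.2 ?_⟩
  ext i j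
  have := h (Pi.single i 1) (Pi.single j 1)
  rw [form_eq, form_eq, Matrix.dotProduct_mulVec, Matrix.vecMul_mulVec,
    ← Matrix.dotProduct_mulVec, Matrix.mulVec_mulVec] at this
  simpa using this

lemma act_one (x : V n K) : act 1 x = x := by simp [act]

lemma act_mul (g h : Sp n K) (x : V n K) : act (g * h) x = act g (act h x) := by
  simp [act, Matrix.mulVec_mulVec]

lemma act_add (g : Sp n K) (x y : V n K) : act g (x + y) = act g x + act g y :=
  Matrix.mulVec_add _ _ _

lemma act_sub (g : Sp n K) (x y : V n K) : act g (x - y) = act g x - act g y :=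
  Matrix.mulVec_sub _ _ _

lemma act_smul (g : Sp n K) (c : K) (x : V n K) : act g (c • x) = c • act g x :=
  Matrix.mulVec_smul _ _ _

lemma mem_M_iff (x : V n K) : x ∈ M n K ↔ projN x = 0 := by
  constructor
  · intro hx
    induction hx using Submodule.span_induction with
    | mem y hy => obtain ⟨i, rfl⟩ := hy; ext j; simp [projN, uVec]
    | zero => rfl
    | add y z _ _ hy hz =>
      have h : projN (y + z) = projN y + projN z := rfl
      rw [h, hy, hz, add_zero]
    | smul c y _ hy =>
      have h : projN (c • y) = c • projN y := rfl
      rw [h, hy, smul_zero]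
  · intro hx
    have : x = ∑ i : Fin n, x (Sum.inl i) • uVec i := by
      ext j
      rcases j with j | j
      · simp [uVec, Finset.sum_apply, Pi.single_apply]
      · have h : x (Sum.inr j) = 0 := congrFun hx j
        simp [uVec, Finset.sum_apply, h]
    rw [this]
    exact Submodule.sum_mem _ fun i _ =>
      Submodule.smul_mem _ _ (Submodule.subset_span ⟨i, rfl⟩)

/-! ### Subgroups of `Sp` -/

section Subgroups

variable (n K) [Finite K]

/-- `Sp^M`, the pointwise stabilizer of `M`. -/
def SpPt : Subgroup (Sp n K) :=
  finiteSubgroup {g | ∀ x ∈ M n K, act g x = x} (fun x _ => act_one x)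
    (fun a b ha hb x hx => by rw [act_mul, hb x hx, ha x hx])

/-- `Sp_M`, the global stabilizer of `M` (for invertible `g`, `gM ⊆ M` means `gM = M`). -/
def SpM : Subgroup (Sp n K) :=
  finiteSubgroup {g | ∀ x ∈ M n K, act g x ∈ M n K} (fun x hx => by rwa [act_one])
    (fun a b ha hb x hx => by rw [act_mul]; exact ha _ (hb x hx))

/-- The global stabilizer of `N`. -/
def SpN : Subgroup (Sp n K) :=
  finiteSubgroup {g | ∀ x ∈ N n K, act g x ∈ N n K} (fun x hx => by rwa [act_one])
    (fun a b ha hb x hx => by rw [act_mul]; exact ha _ (hb x hx))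

/-- `Sp_{M,N}`, the subgroup preserving both `M` and `N`. -/
def SpMN : Subgroup (Sp n K) := SpM n K ⊓ SpN n K

/-- The elements of `Sp` whose upper left `n × n` block is upper triangular with `1`s on the
diagonal and whose lower left block is zero. -/
def upperUni : Subgroup (Sp n K) :=
  finiteSubgroup {g | (∀ i j, g.1 (Sum.inr i) (Sum.inl j) = 0) ∧
      (∀ i j, j < i → g.1 (Sum.inl i) (Sum.inl j) = 0) ∧ ∀ i, g.1 (Sum.inl i) (Sum.inl i) = 1}
    (by
      refine ⟨fun i j => by simp, fun i j h => ?_, fun i => by simp⟩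
      simp [h.ne'])
    (by
      rintro a b ⟨ha0, ha1, ha2⟩ ⟨hb0, hb1, hb2⟩
      refine ⟨fun i j => ?_, fun i j hij => ?_, fun i => ?_⟩
      · simp [Matrix.mul_apply, Fintype.sum_sum_type, ha0, hb0]
      · simp only [Submonoid.coe_mul, Matrix.mul_apply, Fintype.sum_sum_type, hb0, mul_zero,
          Finset.sum_const_zero, add_zero]
        refine Finset.sum_eq_zero fun k _ => ?_
        rcases lt_or_ge k i with h | h
        · rw [ha1 _ _ h, zero_mul]
        · rw [hb1 _ _ (hij.trans_le h), mul_zero]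
      · simp only [Submonoid.coe_mul, Matrix.mul_apply, Fintype.sum_sum_type, hb0, mul_zero,
          Finset.sum_const_zero, add_zero]
        rw [Finset.sum_eq_single i, ha2, hb2, mul_one]
        · intro k _ hk
          rcases lt_or_gt_of_ne hk with h | h
          · rw [ha1 _ _ h, zero_mul]
          · rw [hb1 _ _ h, mul_zero]
        · simp)

/-- `T`: the `g ∈ Sp_{M,N}` with matrix `diag(A, ᵗA⁻¹)`, `A` upper unitriangular. -/
def T : Subgroup (Sp n K) := SpMN n K ⊓ upperUni n K

/-- `U = T ⋉ Sp^M`, a Sylow `p`-subgroup of `Sp`. -/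
def U : Subgroup (Sp n K) := T n K ⊔ SpPt n K

/-- `H`: the `g ∈ Sp_{M,N}` for which all `u_i` and `v_j` are eigenvectors. -/
def H : Subgroup (Sp n K) :=
  SpMN n K ⊓ finiteSubgroup {g | (∀ i, ∃ c : K, act g (uVec i) = c • uVec i) ∧
      ∀ i, ∃ c : K, act g (vVec i) = c • vVec i}
    (⟨fun i => ⟨1, by rw [act_one, one_smul]⟩, fun i => ⟨1, by rw [act_one, one_smul]⟩⟩)
    (by
      rintro a b ⟨ha, ha'⟩ ⟨hb, hb'⟩
      refine ⟨fun i => ?_, fun i => ?_⟩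
      · obtain ⟨c, hc⟩ := ha i
        obtain ⟨d, hd⟩ := hb i
        exact ⟨d * c, by rw [act_mul, hd, act_smul, hc, smul_smul]⟩
      · obtain ⟨c, hc⟩ := ha' i
        obtain ⟨d, hd⟩ := hb' i
        exact ⟨d * c, by rw [act_mul, hd, act_smul, hc, smul_smul]⟩)

/-- `B = U ⋊ H`. -/
def B : Subgroup (Sp n K) := U n K ⊔ H n K

end Subgroups

/-! ### Weyl group -/

variable (K) in
/-- The element `u_i ↦ u_{σ i}`, `v_i ↦ v_{σ i}` of `Sp`, for a permutation `σ`. -/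
def permSp (σ : Equiv.Perm (Fin n)) : Sp n K :=
  ⟨Matrix.fromBlocks (σ⁻¹.permMatrix K) 0 0 (σ⁻¹.permMatrix K), by
    rw [SymplecticGroup.fromBlocks_mem_iff]
    refine ⟨by simp, by simp, ?_⟩
    rw [Matrix.transpose_permMatrix, ← Matrix.permMatrix_mul]
    simp⟩

lemma permSp_uVec (σ : Equiv.Perm (Fin n)) (i : Fin n) :
    act (permSp K σ) (uVec i) = uVec (σ i) := by
  ext j
  rcases j with j | j
  · simp [act, permSp, uVec, Matrix.fromBlocks, Equiv.Perm.permMatrix, Pi.single_apply,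
      Equiv.eq_symm_apply, eq_comm]
  · simp [act, permSp, uVec, Matrix.fromBlocks]

lemma permSp_vVec (σ : Equiv.Perm (Fin n)) (i : Fin n) :
    act (permSp K σ) (vVec i) = vVec (σ i) := by
  ext j
  rcases j with j | j
  · simp [act, permSp, vVec, Matrix.fromBlocks]
  · simp [act, permSp, vVec, Matrix.fromBlocks, Equiv.Perm.permMatrix, Pi.single_apply,
      Equiv.eq_symm_apply, eq_comm]

variable (K) in
/-- The element `c_j`: `u_j ↦ v_j`, `v_j ↦ -u_j`, all other basis vectors fixed. -/
def cElt (j : Fin n) : Sp n K :=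
  ⟨Matrix.fromBlocks (Matrix.diagonal (1 - Pi.single j 1)) (-Matrix.diagonal (Pi.single j 1))
      (Matrix.diagonal (Pi.single j 1)) (Matrix.diagonal (1 - Pi.single j 1)), by
    rw [SymplecticGroup.fromBlocks_mem_iff]
    simp only [Matrix.diagonal_transpose, Matrix.transpose_neg, Matrix.neg_mul, Matrix.mul_neg,
      Matrix.diagonal_mul_diagonal, sub_neg_eq_add, Matrix.diagonal_add, ← Matrix.diagonal_one]
    refine ⟨?_, ?_, ?_⟩
    · congr 1; ext i; ring
    · congr 2; ext i; ring
    · congr 1; ext i; by_cases h : i = j <;> simp [h]⟩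

lemma cElt_uVec (j i : Fin n) :
    act (cElt K j) (uVec i) = if i = j then vVec j else uVec i := by
  ext k
  rcases k with k | k <;> by_cases h : i = j <;> by_cases h' : k = i <;>
    simp_all [act, cElt, uVec, vVec, Matrix.fromBlocks, Matrix.diagonal, Pi.single_apply]

lemma cElt_vVec (j i : Fin n) :
    act (cElt K j) (vVec i) = if i = j then -uVec j else vVec i := by
  ext k
  rcases k with k | k <;> by_cases h : i = j <;> by_cases h' : k = i <;>
    simp_all [act, cElt, uVec, vVec, Matrix.fromBlocks, Matrix.diagonal, Pi.single_apply]

variable (n K) in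
/-- The set `{w_1, …, w_{n-1}}`, where `w_i = (u_i, u_{i+1})(v_i, v_{i+1})`. -/
def wSet : Set (Sp n K) :=
  {g | ∃ i j : Fin n, i.val + 1 = j.val ∧ g = permSp K (Equiv.swap i j)}

variable (n K) in
/-- `W_2 = ⟨c_1, …, c_n, w_1, …, w_{n-1}⟩`. -/
def W2 : Subgroup (Sp n K) := Subgroup.closure (wSet n K ∪ Set.range (cElt K))

section Steinberg

variable [NeZero n] [Finite K]

variable (n K) in
/-- The fundamental letters `w_1, …, w_{n-1}, c_n`. -/
def letters : Set (Sp n K) := wSet n K ∪ {cElt K ⊤}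

/-- `ℓ(w)`: the length of a shortest word in `w_1 H, …, w_{n-1} H, c_n H` that equals `wH`. -/
def weylLength (x : Sp n K) : ℕ :=
  sInf {k | ∃ L : List (Sp n K), (∀ s ∈ L, s ∈ letters n K) ∧ L.length = k ∧
    L.prod⁻¹ * x ∈ H n K}

variable (n K) in
/-- The Weyl group `W = W_2 H / H ≅ W_2 / (W_2 ∩ H)`, as a set of cosets. -/
abbrev Weyl : Type u := W2 n K ⧸ (H n K).subgroupOf (W2 n K)

/-- A representative `n_w ∈ W_2` of `w ∈ W`. -/
def weylRep (c : Weyl n K) : Sp n K := (Quotient.out c : W2 n K)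

variable (F : Type v) [Field F]

variable (n K) in
/-- Steinberg's element `e = (∑_{w ∈ W} (-1)^{ℓ(w)} n_w) (∑_{b ∈ B} b)` of `F Sp`. It does not
depend on the choice of the representatives `n_w`. -/
def eSt : F[Sp n K] :=
  (∑ᶠ c : Weyl n K,
      ((-1 : F) ^ weylLength (weylRep c)) • MonoidAlgebra.of F (Sp n K) (weylRep c)) *
    ∑ᶠ b : B n K, MonoidAlgebra.of F (Sp n K) b

variable (n K) in
/-- The Steinberg module: the left ideal `I = F Sp · e`, as an `F`-subspace of `F Sp`. -/
def steinberg : Submodule F F[Sp n K] := (Ideal.span {eSt n K F}).restrictScalars F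

variable (n K) in
/-- Left multiplication of `Sp_M` on the group algebra `F Sp`. -/
def leftMul : Representation F (SpM n K) F[Sp n K] :=
  ((Algebra.lmul F F[Sp n K]) : F[Sp n K] →* Module.End F F[Sp n K]).comp
    ((MonoidAlgebra.of F (Sp n K)).comp (SpM n K).subtype)

variable {F}

/-- `χ_v(g) = λ(⟨gv, v⟩)`. -/
def chi (lam : AddChar K F) (x : V n K) (g : Sp n K) : F := lam (form (act g x) x)

/-- `e_σ = ∑_{u ∈ U} σ(u)⁻¹ u e`. -/
def eChar (σ : Sp n K → F) : F[Sp n K] :=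
  ∑ᶠ u : U n K, (σ u)⁻¹ • (MonoidAlgebra.of F (Sp n K) u * eSt n K F)

variable (K) in
/-- `w(i)`: cyclically `u_n ↦ u_i ↦ u_{i+1} ↦ ⋯ ↦ u_{n-1} ↦ u_n`, and likewise for the `v_j`. -/
def wCyc (i : Fin n) : Sp n K := permSp K (Fin.cycleIcc i ⊤)

/-- `I_{α,i}`: the `FU`-module generated by `w(i) e_{χ_{α v_n}}`. -/
def IMod₂ (lam : AddChar K F) (α : K) (i : Fin n) : Submodule F F[Sp n K] :=
  Submodule.span F (Set.range fun u : U n K =>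
    MonoidAlgebra.of F (Sp n K) u *
      (MonoidAlgebra.of F (Sp n K) (wCyc K i) * eChar (chi lam (α • vVec ⊤))))

/-- `Tq` is a transversal for the action of `{1, -1}` on `K \ {0}`. -/
def IsTransversal (Tq : Set Kˣ) : Prop := ∀ α : Kˣ, ∃! β : Kˣ, β ∈ Tq ∧ (β = α ∨ β = -α)

/-- `I_i`: the sum of the `I_{α,i}`, `α ∈ Tq`. -/
def IMod (lam : AddChar K F) (Tq : Set Kˣ) (i : Fin n) : Submodule F F[Sp n K] :=
  ⨆ α ∈ Tq, IMod₂ lam (α : K) i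

variable (n) in
/-- `L`: the sum of all `I_i`. -/
def LMod (lam : AddChar K F) (Tq : Set Kˣ) : Submodule F F[Sp n K] := ⨆ i : Fin n, IMod lam Tq i

end Steinberg

/-! ### The `Sp_M`-modules `X` and `X⁺` -/

section Weil


/-- The action of `g ∈ Sp` on `N ≅ V / M`, in coordinates. -/
def actN (g : Sp n K) (x : Fin n → K) : Fin n → K := projN (act g (ofN x))

lemma form_add_left (x y z : V n K) : form (x + y) z = form x z + form y z := by
  simp only [form, ← Finset.sum_add_distrib]
  exact Finset.sum_congr rfl fun i _ => by simp; ring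

lemma form_add_right (x y z : V n K) : form z (x + y) = form z x + form z y := by
  simp only [form, ← Finset.sum_add_distrib]
  exact Finset.sum_congr rfl fun i _ => by simp; ring

lemma form_M {x y : V n K} (hx : x ∈ M n K) (hy : y ∈ M n K) : form x y = 0 := by
  have hx' := (mem_M_iff x).1 hx
  have hy' := (mem_M_iff y).1 hy
  refine Finset.sum_eq_zero fun i _ => ?_
  have h1 := congrFun hx' i
  have h2 := congrFun hy' i
  simp only [projN, Pi.zero_apply] at h1 h2
  rw [h1, h2]; ring

lemma form_N (x y : Fin n → K) : form (ofN x) (ofN y) = 0 :=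
  Finset.sum_eq_zero fun i _ => by simp [ofN]

lemma decomp (x : V n K) : ∃ m ∈ M n K, x = m + ofN (projN x) := by
  refine ⟨x - ofN (projN x), ?_, by simp⟩
  rw [mem_M_iff]
  ext i
  simp [projN, ofN]

lemma projN_add (x y : V n K) : projN (x + y) = projN x + projN y := rfl

lemma projN_ofN (x : Fin n → K) : projN (ofN x : V n K) = x := rfl

lemma actN_one (x : Fin n → K) : actN (1 : Sp n K) x = x := by
  rw [actN, act_one, projN_ofN]

lemma act_neg (g : Sp n K) (x : V n K) : act g (-x) = -act g x := Matrix.mulVec_neg _ _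

lemma ofN_neg (x : Fin n → K) : (ofN (-x) : V n K) = -ofN x := by
  ext j; rcases j with j | j <;> simp [ofN]

lemma form_neg_neg (x y : V n K) : form (-x) (-y) = form x y := by
  simp [form]

lemma actN_neg (g : Sp n K) (x : Fin n → K) : actN g (-x) = -actN g x := by
  rw [actN, ofN_neg, act_neg]; rfl

lemma mem_N_iff (x : V n K) : x ∈ N n K ↔ x = ofN (projN x) := by
  constructor
  · intro hx
    induction hx using Submodule.span_induction with
    | mem y hy =>
      obtain ⟨i, rfl⟩ := hy
      ext j
      rcases j with j | j <;> simp [projN, ofN, vVec]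
    | zero => ext j; rcases j with j | j <;> simp [projN, ofN]
    | add y z _ _ hy hz =>
      ext j
      have h1 := congrFun hy j
      have h2 := congrFun hz j
      rcases j with j | j
      · simp only [ofN, Sum.elim_inl, Pi.zero_apply] at h1 h2
        simp [ofN, h1, h2]
      · simp [ofN, projN]
    | smul c y _ hy =>
      ext j
      have h1 := congrFun hy j
      rcases j with j | j
      · simp only [ofN, Sum.elim_inl, Pi.zero_apply] at h1
        simp [ofN, h1]
      · simp [ofN, projN]
  · intro hx
    have : x = ∑ i : Fin n, x (Sum.inr i) • vVec i := by
      ext j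
      rcases j with j | j
      · simpa [vVec, ofN, Finset.sum_apply, Pi.single_apply] using congrFun hx (Sum.inl j)
      · simp [vVec, Finset.sum_apply, Pi.single_apply]
    rw [this]
    exact Submodule.sum_mem _ fun i _ =>
      Submodule.smul_mem _ _ (Submodule.subset_span ⟨i, rfl⟩)

variable [Finite K] {F : Type v} [Field F]

lemma actN_mul {g : Sp n K} (hg : g ∈ SpM n K) (h : Sp n K) (x : Fin n → K) :
    actN (g * h) x = actN g (actN h x) := by
  obtain ⟨m, hm, e⟩ := decomp (act h (ofN x))
  rw [actN, act_mul, e, act_add, projN_add, (mem_M_iff _).1 (hg m hm), zero_add]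
  rfl

lemma form_cocycle {g : Sp n K} (hg : g ∈ SpM n K) (h : Sp n K) (x : Fin n → K) :
    form (act (g * h) (ofN x)) (ofN (actN (g * h) x)) =
      form (act h (ofN x)) (ofN (actN h x)) +
        form (act g (ofN (actN h x))) (ofN (actN g (actN h x))) := by
  rw [actN_mul hg, act_mul]
  obtain ⟨m, hm, e⟩ := decomp (act h (ofN x))
  obtain ⟨m', hm', e'⟩ := decomp (act g (ofN (actN h x)))
  change _ = m + ofN (actN h x) at e
  change _ = m' + ofN (actN g (actN h x)) at e'
  have key : form (act g m) (ofN (actN g (actN h x))) = form m (ofN (actN h x)) := by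
    rw [← form_act g m, e', form_add_right, form_M (hg m hm) hm', zero_add]
  rw [e, act_add, form_add_left, key, form_add_left m, form_N, add_zero]

/-- The representation of `Sp_M` on the space `X` with basis `(E_x)_{x ∈ N}`, where
`g E_x = λ(⟨gx, y⟩) E_y` and `y` is the projection of `gx` to `N` along `M`. For `g = sa` with
`s ∈ Sp^M` and `a ∈ Sp_{M,N}` one has `y = ax`, see `XRep_apply`. -/
def XRep (lam : AddChar K F) : Representation F (SpM n K) ((Fin n → K) →₀ F) where
  toFun g := Finsupp.lsum F fun x : Fin n → K =>
    lam (form (act g.1 (ofN x)) (ofN (actN g.1 x))) • Finsupp.lsingle (actN g.1 x)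
  map_one' := by
    ext x : 2
    simp [actN_one, act_one, form_N]
  map_mul' g h := by
    ext x : 2
    have h1 := form_cocycle g.2 h.1 x
    simp only [actN_mul g.2] at h1
    simp [actN_mul g.2, h1, AddChar.map_add_eq_mul]
    exact mul_comm _ _

lemma XRep_single (lam : AddChar K F) (g : SpM n K) (x : Fin n → K) :
    XRep lam g (Finsupp.single x 1) =
      Finsupp.single (actN g.1 x) (lam (form (act g.1 (ofN x)) (ofN (actN g.1 x)))) := by
  simp [XRep]

/-- The defining formula `R(sa) E_x = λ(⟨sax, ax⟩) E_{ax}`, for `s ∈ Sp^M`, `a ∈ Sp_{M,N}`,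
`x ∈ N`; here `ax ∈ N`. -/
lemma XRep_apply (lam : AddChar K F) (s a : Sp n K) (hs : s ∈ SpPt n K) (ha : a ∈ SpMN n K)
    (hsa : s * a ∈ SpM n K) (x : Fin n → K) :
    act a (ofN x) ∈ N n K ∧ XRep lam ⟨s * a, hsa⟩ (Finsupp.single x 1) =
      Finsupp.single (projN (act a (ofN x)))
        (lam (form (act (s * a) (ofN x)) (act a (ofN x)))) := by
  have hN : act a (ofN x) ∈ N n K := ha.2 _ ((mem_N_iff _).2 (by rw [projN_ofN]))
  refine ⟨hN, ?_⟩
  have hy : act a (ofN x) = ofN (actN a x) := (mem_N_iff _).1 hN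
  have hsM : s ∈ SpM n K := fun z hz => by
    have : act s z = z := hs z hz
    rwa [this]
  have hs' : ∀ y : Fin n → K, actN s y = y := by
    intro y
    ext i
    have h1 := form_act s (uVec i) (ofN y)
    have h2 : act s (uVec i) = uVec i := hs _ (Submodule.subset_span ⟨i, rfl⟩)
    have hf : ∀ z : V n K, form (uVec i) z = z (Sum.inr i) := by
      intro z
      simp [form, uVec, Pi.single_apply]
    rw [h2, hf, hf] at h1
    exact h1
  have hact : actN (s * a) x = actN a x := by rw [actN_mul hsM, hs']
  rw [XRep_single]
  simp only [hact, hy, projN_ofN]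

open Classical in
/-- `E⁺_x = E_x + E_{-x}` in odd characteristic, and `E⁺_x = E_x` if `K` has characteristic `2`. -/
def EPlus (K : Type u) [Field K] (F : Type v) [Field F] (x : Fin n → K) : (Fin n → K) →₀ F :=
  if ringChar K = 2 then Finsupp.single x 1 else Finsupp.single x 1 + Finsupp.single (-x) 1

lemma XRep_EPlus (lam : AddChar K F) (g : SpM n K) (x : Fin n → K) :
    XRep lam g (EPlus K F x) =
      lam (form (act g.1 (ofN x)) (ofN (actN g.1 x))) • EPlus K F (actN g.1 x) := by
  unfold EPlus
  split_ifs with h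
  · rw [XRep_single]; simp
  · rw [map_add, XRep_single, XRep_single, actN_neg, ofN_neg, ofN_neg, act_neg, form_neg_neg]
    simp

lemma actN_ne_zero (g : SpM n K) {x : Fin n → K} (hx : x ≠ 0) : actN g.1 x ≠ 0 := by
  intro h
  apply hx
  have h1 := actN_mul (g⁻¹).2 g.1 x
  rw [h, ← Subgroup.coe_mul, inv_mul_cancel, Subgroup.coe_one, actN_one] at h1
  rw [h1]
  ext i
  simp [actN, ofN, act, projN, Matrix.mulVec, dotProduct]

variable (n) in
/-- `X⁺ = X⁺_λ`: the `Sp_M`-submodule of `X` spanned by the `E⁺_x`, `0 ≠ x ∈ N`. -/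
def XPlus (lam : AddChar K F) : Subrepresentation (XRep (n := n) lam) where
  toSubmodule := Submodule.span F {y | ∃ x : Fin n → K, x ≠ 0 ∧ y = EPlus K F x}
  apply_mem_toSubmodule g y hy := by
    induction hy using Submodule.span_induction with
    | mem y hy =>
      obtain ⟨x, hx, rfl⟩ := hy
      rw [XRep_EPlus]
      exact Submodule.smul_mem _ _ (Submodule.subset_span ⟨_, actN_ne_zero g hx, rfl⟩)
    | zero => rw [map_zero]; exact Submodule.zero_mem _
    | add y z _ _ hy hz => rw [map_add]; exact Submodule.add_mem _ hy hz
    | smul c y _ hy => rw [map_smul]; exact Submodule.smul_mem _ _ hy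

end Weil

end

end SymplecticSteinberg

/-! Write `χ` for `χ_{v_n}`. The heart of the matter is that, when `q = -1` in `F`, the line spanned
by `e_χ` is stable under every element of `Sp_M` that fixes `±v_n` modulo `M`, and that such an
element multiplies `e_χ` by the same scalar as `E⁺_{v_n}` (`of_mul_eChar`). Granted this, the
`Sp_M`-translates of `e_χ`, suitably rescaled, depend only on a nonzero vector of `N` up to sign,
and they transform exactly like the vectors `E⁺_x`.

For `U` the eigenvector property holds by construction, and elements of `H` fixing `v_n` fix `e_χ`
because `H` fixes `e` and normalizes `U`. The missing generators are the reflections `w` that fix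
`v_n`. Let `x(t)` be the root subgroup of `w` and `z = ∑ x(t) e`. Steinberg's relation `w x(t) e =
x(1/t) e - e` for `t ≠ 0`, together with `w e = -e`, gives `w z = z - (q + 1) e = z`
(`swap_mul_sum_root`). This is the only use of the hypothesis on `l`. For adjacent indices, `e_χ` is
a combination of the `u z`, with `u` in a complement of the root subgroup in `U` that `w`
normalizes, so `w` fixes `e_χ` (`swap_mul_eChar`). Gaussian elimination then reaches the full
stabilizer (`mem_eigenStab`).

The space `L` is spanned by the translates of `e_χ` (`LMod_eq_span`), because `U` is transitive on
the vectors of `N` with a prescribed leading coordinate. Hence `E⁺_x ↦` translate is an `Sp_M`-map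
from `X⁺` onto `L`.

Finally `Sp^M` acts diagonally on the `E⁺_x` by the characters `λ(ᵗx S x)`, `S` symmetric, which
separate vectors up to sign, while `Sp_M` permutes these vectors transitively up to scalars. This
makes `X⁺` irreducible, also after any extension of scalars (`IsMonomialFamily`). So the map is
injective once it is nonzero, which follows from `e_χ ≠ 0`: its coefficient at the longest Weyl
element is a unit (`eChar_ne_zero`). -/

namespace SymplecticSteinberg

open Matrix
open scoped MonoidAlgebra TensorProduct

noncomputable section

set_option linter.unusedSectionVars false

universe u v w

/-! ### A monomial criterion for absolute irreducibility -/

section Irreducibility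

variable {F : Type u} {G : Type v} {V : Type w} [Field F] [Group G] [AddCommGroup V] [Module F V]

/-- A spanning family of nonzero vectors which are permuted transitively up to scalars and which
are pairwise separated by group elements that act diagonally. -/
structure IsMonomialFamily (ρ : Representation F G V) {ι : Type*} (b : ι → V) : Prop where
  nonempty : Nonempty ι
  span_eq : Submodule.span F (Set.range b) = ⊤
  ne_zero : ∀ i, b i ≠ 0
  separated : ∀ i k, i ≠ k → ∃ (g : G) (ψ : ι → F), (∀ m, ρ g (b m) = ψ m • b m) ∧ ψ i ≠ ψ k
  transitive : ∀ i k, ∃ (g : G) (c : F), c ≠ 0 ∧ ρ g (b i) = c • b k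

namespace IsMonomialFamily

variable {ρ : Representation F G V} {ι : Type*} {b : ι → V}

/-- A diagonal operator in the span of the group isolates one member among finitely many. -/
lemma exists_isolating (hb : IsMonomialFamily ρ b) (i : ι) (s : Finset ι) :
    ∃ (t : Module.End F V) (ψ : ι → F), (∀ S : Subrepresentation ρ, ∀ x ∈ S.toSubmodule,
      t x ∈ S.toSubmodule) ∧ (∀ m, t (b m) = ψ m • b m) ∧ ψ i ≠ 0 ∧
      ∀ k ∈ s, k ≠ i → ψ k = 0 := by
  classical
  induction s using Finset.induction_on with
  | empty => exact ⟨1, 1, fun _ _ h => h, by simp, by simp, by simp⟩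
  | insert j s _ ih =>
    obtain ⟨t, ψ, h1, h2, h3, h4⟩ := ih
    rcases eq_or_ne j i with rfl | hji
    · exact ⟨t, ψ, h1, h2, h3, fun k hk hki => h4 k (Finset.mem_of_mem_insert_of_ne hk hki) hki⟩
    · obtain ⟨g, φ, h5, h6⟩ := hb.separated i j hji.symm
      -- The new factor kills `b j` and multiplies `b i` by `φ i - φ j ≠ 0`.
      refine ⟨(ρ g - φ j • 1) * t, fun m => (φ m - φ j) * ψ m, fun S x hx => ?_, fun m => ?_,
        mul_ne_zero (sub_ne_zero.2 h6) h3, fun k hk hki => ?_⟩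
      · exact S.toSubmodule.sub_mem (S.apply_mem_toSubmodule g (h1 S x hx))
          (S.toSubmodule.smul_mem _ (h1 S x hx))
      · simp [h2, h5, sub_smul, mul_smul, smul_comm (ψ m), smul_sub]
      · rcases Finset.mem_insert.1 hk with rfl | hk
        · simp
        · simp [h4 k hk hki]

/-- An isolating operator applied to a nonzero vector of a submodule leaves a nonzero multiple of
one `b i`, and transitivity then produces the whole family. Linear independence is not assumed: any
expression of the vector with a nonzero coefficient serves. -/
theorem isIrreducible (hb : IsMonomialFamily ρ b) : ρ.IsIrreducible := by
  obtain ⟨i₀⟩ := hb.nonempty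
  have hnt : Nontrivial (Subrepresentation ρ) := by
    refine ⟨⊥, ⊤, fun h => hb.ne_zero i₀ ?_⟩
    have : b i₀ ∈ (⊤ : Subrepresentation ρ).toSubmodule := Submodule.mem_top (R := F) (x := b i₀)
    rw [← h] at this
    exact (Submodule.mem_bot F).1 this
  refine ⟨fun S => or_iff_not_imp_left.2 fun hS => ?_⟩
  obtain ⟨x, hx, hx0⟩ : ∃ x ∈ S.toSubmodule, x ≠ 0 := by
    by_contra! h
    exact hS (Subrepresentation.toSubmodule_injective ((Submodule.eq_bot_iff _).2 h))
  have hspan : x ∈ Submodule.span F (Set.range b) := hb.span_eq ▸ Submodule.mem_top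
  obtain ⟨c, rfl⟩ := (Finsupp.mem_span_range_iff_exists_finsupp).1 hspan
  obtain ⟨i, hi⟩ : ∃ i, c i ≠ 0 := by
    by_contra! h
    exact hx0 (by simp [Finsupp.sum, h])
  obtain ⟨t, ψ, h1, h2, h3, h4⟩ := hb.exists_isolating i c.support
  have h5 := h1 S _ hx
  have h6 : t (c.sum fun i a => a • b i) = (c i * ψ i) • b i := by
    rw [Finsupp.sum, map_sum, Finset.sum_eq_single i]
    · rw [map_smul, h2, smul_smul]
    · intro k hk hki
      rw [map_smul, h2, h4 k hk hki, zero_smul, smul_zero]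
    · intro h
      simp [Finsupp.notMem_support_iff.1 h]
  rw [h6, Submodule.smul_mem_iff _ (mul_ne_zero hi h3)] at h5
  apply Subrepresentation.toSubmodule_injective
  change S.toSubmodule = ⊤
  rw [eq_top_iff, ← hb.span_eq, Submodule.span_le]
  rintro _ ⟨k, rfl⟩
  obtain ⟨g, a, ha, hg⟩ := hb.transitive i k
  have h7 := S.apply_mem_toSubmodule g h5
  rwa [hg, Submodule.smul_mem_iff _ ha] at h7

/-- All conditions are equations and inequalities between scalars of `F`, so they survive a field
extension. This turns irreducibility into absolute irreducibility with no hypothesis on `F`. -/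
lemma extendScalars (hb : IsMonomialFamily ρ b) (E : Type u) [Field E] [Algebra F E] :
    IsMonomialFamily (extendScalars ρ E) fun i => (1 : E) ⊗ₜ[F] b i := by
  have key : ∀ g i, SymplecticSteinberg.extendScalars ρ E g ((1 : E) ⊗ₜ[F] b i) =
      (1 : E) ⊗ₜ[F] ρ g (b i) := fun g i =>
    LinearMap.baseChange_tmul _ _ _
  have smul : ∀ (c : F) (x : V), (1 : E) ⊗ₜ[F] (c • x) = algebraMap F E c • ((1 : E) ⊗ₜ[F] x) :=
    fun c x => by rw [TensorProduct.tmul_smul, algebraMap_smul]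
  refine ⟨hb.nonempty, ?_, fun i h => hb.ne_zero i ?_, fun i k hik => ?_, fun i k => ?_⟩
  · have h := Submodule.baseChange_span (A := E) (R := F) (Set.range b)
    rw [hb.span_eq, Submodule.baseChange_top, ← Set.range_comp] at h
    exact h.symm
  · exact (Module.FaithfullyFlat.one_tmul_eq_zero_iff F V (A := E) _).1 h
  · obtain ⟨g, ψ, h1, h2⟩ := hb.separated i k hik
    exact ⟨g, fun m => algebraMap F E (ψ m), fun m => by rw [key, h1, smul],
      fun h => h2 ((algebraMap F E).injective h)⟩
  · obtain ⟨g, c, hc, h⟩ := hb.transitive i k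
    exact ⟨g, algebraMap F E c, by simpa using hc, by rw [key, h, smul]⟩

theorem isAbsolutelyIrreducible (hb : IsMonomialFamily ρ b) : IsAbsolutelyIrreducible ρ :=
  fun E _ _ => (hb.extendScalars E).isIrreducible

lemma map {V' : Type*} [AddCommGroup V'] [Module F V'] {ρ' : Representation F G V'}
    (hb : IsMonomialFamily ρ b) (e : ρ.Equiv ρ') : IsMonomialFamily ρ' fun i => e (b i) := by
  have key : ∀ g x, ρ' g (e x) = e (ρ g x) := fun g x =>
    (LinearMap.congr_fun (e.toIntertwiningMap.isIntertwining' g) x).symm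
  refine ⟨hb.nonempty, ?_, fun i h => hb.ne_zero i ?_, fun i k hik => ?_, fun i k => ?_⟩
  · have h := Submodule.map_span e.toLinearEquiv.toLinearMap (Set.range b)
    rw [hb.span_eq, Submodule.map_top, LinearEquiv.range, ← Set.range_comp] at h
    exact h.symm
  · exact e.toLinearEquiv.map_eq_zero_iff.1 h
  · obtain ⟨g, ψ, h1, h2⟩ := hb.separated i k hik
    exact ⟨g, ψ, fun m => by rw [key, h1]; exact e.toLinearEquiv.map_smul _ _, h2⟩
  · obtain ⟨g, c, hc, h⟩ := hb.transitive i k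
    exact ⟨g, c, hc, by rw [key, h]; exact e.toLinearEquiv.map_smul _ _⟩

end IsMonomialFamily

end Irreducibility

variable {n : ℕ} {K : Type u} [Field K]

/-! ### Matrix entries and block descriptions of the subgroups -/

lemma act_uVec (g : Sp n K) (i : Fin n) (a : Fin n ⊕ Fin n) :
    act g (uVec i) a = g.1 a (Sum.inl i) := by
  simp [act, uVec]

lemma act_vVec (g : Sp n K) (i : Fin n) (a : Fin n ⊕ Fin n) :
    act g (vVec i) a = g.1 a (Sum.inr i) := by
  simp [act, vVec]

lemma act_single (g : Sp n K) (a b : Fin n ⊕ Fin n) :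
    act g (Pi.single b 1) a = g.1 a b := by
  simp [act]

lemma Sp_ext {g h : Sp n K} (hu : ∀ i, act g (uVec i) = act h (uVec i))
    (hv : ∀ i, act g (vVec i) = act h (vVec i)) : g = h := by
  apply Subtype.ext
  ext a (i | i)
  · rw [← act_uVec, ← act_uVec, hu]
  · rw [← act_vVec, ← act_vVec, hv]

lemma act_zero (g : Sp n K) : act g 0 = 0 := Matrix.mulVec_zero _

lemma act_injective (g : Sp n K) : Function.Injective (act g) := fun x y h => by
  rw [← act_one x, ← act_one y, ← inv_mul_cancel g, act_mul, act_mul, h]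

lemma permSp_mul (σ τ : Equiv.Perm (Fin n)) : permSp K (σ * τ) = permSp K σ * permSp K τ :=
  Sp_ext (fun i => by simp [act_mul, permSp_uVec]) fun i => by simp [act_mul, permSp_vVec]

lemma permSp_one : permSp K (1 : Equiv.Perm (Fin n)) = 1 :=
  Sp_ext (fun i => by simp [act_one, permSp_uVec]) fun i => by simp [act_one, permSp_vVec]

lemma permSp_swap_mul_self (i j : Fin n) :
    permSp K (Equiv.swap i j) * permSp K (Equiv.swap i j) = 1 := by
  rw [← permSp_mul, Equiv.swap_mul_self, permSp_one]

lemma permSp_swap_inv (i j : Fin n) :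
    (permSp K (Equiv.swap i j))⁻¹ = permSp K (Equiv.swap i j) :=
  inv_eq_of_mul_eq_one_left (permSp_swap_mul_self i j)

/-- Conjugating `(i k)` by the adjacent transposition `(k j)` gives `(i j)`, which allows induction
on the distance. The bound `m` keeps the process among indices below `n`, as is needed when only
reflections fixing `v_n` are available. -/
lemma permSp_swap_mem {S : Subgroup (Sp n K)} {m : Fin n}
    (hS : ∀ i j : Fin n, i.val + 1 = j.val → j ≤ m → permSp K (Equiv.swap i j) ∈ S) (i j : Fin n)
    (hi : i ≤ m) (hj : j ≤ m) : permSp K (Equiv.swap i j) ∈ S := by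
  have key : ∀ (d : ℕ) (i j : Fin n), i.val + 1 + d = j.val → j ≤ m →
      permSp K (Equiv.swap i j) ∈ S := by
    intro d
    induction d with
    | zero => exact fun i j h hj => hS i j (by omega) hj
    | succ d ih =>
      intro i j h hj
      let k : Fin n := ⟨i + 1 + d, by omega⟩
      have h1 := hS k j (by simp [k]; omega) hj
      have h2 := ih i k rfl (by rw [Fin.le_def] at hj ⊢; simp [k]; omega)
      have h3 : Equiv.swap k j * Equiv.swap i k * Equiv.swap k j = Equiv.swap j i :=
        Equiv.swap_mul_swap_mul_swap (by rw [Ne, Fin.ext_iff]; simp [k]; omega)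
          (by rw [Ne, Fin.ext_iff]; omega)
      rw [Equiv.swap_comm, ← h3, permSp_mul, permSp_mul]
      exact S.mul_mem (S.mul_mem h1 h2) h1
  rcases lt_trichotomy i j with h | rfl | h
  · exact key (j - i - 1) i j (by rw [Fin.lt_def] at h; omega) hj
  · rw [Equiv.swap_self]
    exact (permSp_one (K := K) (n := n)) ▸ S.one_mem
  · rw [Equiv.swap_comm]
    exact key (i - j - 1) j i (by rw [Fin.lt_def] at h; omega) hi

section Blocks

variable [Finite K]

lemma mem_SpM_iff {g : Sp n K} : g ∈ SpM n K ↔ ∀ i j, g.1 (Sum.inr i) (Sum.inl j) = 0 := by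
  constructor
  · intro h i j
    have := congrFun ((mem_M_iff _).1 (h (uVec j) (Submodule.subset_span ⟨j, rfl⟩))) i
    rwa [projN, act_uVec] at this
  · intro h x hx
    rw [mem_M_iff] at hx ⊢
    ext i
    have hx' : ∀ j, x (Sum.inr j) = 0 := congrFun hx
    simp [projN, act, Matrix.mulVec, dotProduct, Fintype.sum_sum_type, h, hx']

lemma mem_SpN_of_block {g : Sp n K} (h : ∀ i j, g.1 (Sum.inl i) (Sum.inr j) = 0) :
    g ∈ SpN n K := by
  intro x hx
  rw [mem_N_iff] at hx ⊢
  have hx' : ∀ j, x (Sum.inl j) = 0 := fun j => congrFun hx (Sum.inl j)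
  ext (i | i)
  · simp [ofN, act, Matrix.mulVec, dotProduct, Fintype.sum_sum_type, h, hx']
  · rfl

lemma mem_SpPt_of_uVec {g : Sp n K} (h : ∀ i, act g (uVec i) = uVec i) : g ∈ SpPt n K := by
  intro x hx
  induction hx using Submodule.span_induction with
  | mem y hy => obtain ⟨i, rfl⟩ := hy; exact h i
  | zero => exact act_zero g
  | add y z _ _ hy hz => rw [act_add, hy, hz]
  | smul c y _ hy => rw [act_smul, hy]

lemma act_uVec_of_mem_SpPt {g : Sp n K} (h : g ∈ SpPt n K) (i : Fin n) : act g (uVec i) = uVec i :=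
  h _ (Submodule.subset_span ⟨i, rfl⟩)

lemma SpPt_le_upperUni : SpPt n K ≤ upperUni n K := by
  intro g hg
  have h : ∀ a i, g.1 a (Sum.inl i) = (uVec i : V n K) a := fun a i => by
    rw [← act_uVec, act_uVec_of_mem_SpPt hg]
  refine ⟨fun i j => ?_, fun i j hij => ?_, fun i => ?_⟩
  · simp [h, uVec]
  · simp [h, uVec, hij.ne']
  · simp [h, uVec]

lemma SpPt_le_SpM : SpPt n K ≤ SpM n K := fun _ hg => mem_SpM_iff.2 (SpPt_le_upperUni hg).1

lemma upperUni_le_SpM : upperUni n K ≤ SpM n K := fun _ hg => mem_SpM_iff.2 hg.1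

lemma toBlocks_transpose_mul {g : Sp n K} (hg : g ∈ SpM n K) :
    g.1.toBlocks₁₁ᵀ * g.1.toBlocks₂₂ = 1 := by
  have h := g.2
  rw [← Matrix.fromBlocks_toBlocks g.1, SymplecticGroup.fromBlocks_mem_iff] at h
  have h0 : g.1.toBlocks₂₁ = 0 := by
    ext i j
    exact mem_SpM_iff.1 hg i j
  simpa [h0] using h.2.2

variable (n K) in
/-- The element `diag(A, ᵗA⁻¹)` of `Sp`. -/
def levi : GL (Fin n) K →* Sp n K where
  toFun A := ⟨Matrix.fromBlocks A 0 0 (A⁻¹ : GL (Fin n) K).1ᵀ, by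
    rw [SymplecticGroup.fromBlocks_mem_iff]
    refine ⟨by simp, by simp, ?_⟩
    rw [← Matrix.transpose_mul, ← Units.val_mul]
    simp⟩
  map_one' := by
    apply Subtype.ext
    simp
  map_mul' A B := by
    apply Subtype.ext
    simp [Matrix.fromBlocks_multiply]

lemma levi_mem_SpMN (A : GL (Fin n) K) : levi n K A ∈ SpMN n K :=
  ⟨mem_SpM_iff.2 fun _ _ => rfl, mem_SpN_of_block fun _ _ => rfl⟩

/-- The invertible upper left block of an element of `Sp_M`. -/
lemma exists_GL {g : Sp n K} (hg : g ∈ SpM n K) :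
    ∃ A : GL (Fin n) K, A.1 = g.1.toBlocks₁₁ ∧ (A⁻¹ : GL (Fin n) K).1ᵀ = g.1.toBlocks₂₂ := by
  have h := toBlocks_transpose_mul hg
  have h' : g.1.toBlocks₂₂ᵀ * g.1.toBlocks₁₁ = 1 := by
    rw [← Matrix.transpose_transpose g.1.toBlocks₁₁, ← Matrix.transpose_mul, h,
      Matrix.transpose_one]
  exact ⟨⟨g.1.toBlocks₁₁, g.1.toBlocks₂₂ᵀ, mul_eq_one_comm.1 h', h'⟩, rfl,
    Matrix.transpose_transpose _⟩

/-- The decomposition `Sp_M = Sp_{M,N} Sp^M`. -/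
lemma exists_levi_mul {g : Sp n K} (hg : g ∈ SpM n K) :
    ∃ A : GL (Fin n) K, A.1 = g.1.toBlocks₁₁ ∧ (A⁻¹ : GL (Fin n) K).1ᵀ = g.1.toBlocks₂₂ ∧
      (levi n K A)⁻¹ * g ∈ SpPt n K := by
  obtain ⟨A, hA, hA'⟩ := exists_GL hg
  refine ⟨A, hA, hA', mem_SpPt_of_uVec fun i => ?_⟩
  have h : act g (uVec i) = act (levi n K A) (uVec i) := by
    ext (j | j)
    · rw [act_uVec, act_uVec]
      exact (congrFun (congrFun hA j) i).symm
    · rw [act_uVec, act_uVec, mem_SpM_iff.1 hg]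
      rfl
  rw [act_mul, h, ← act_mul, inv_mul_cancel, act_one]

/-- Splitting off `diag(A, ᵗA⁻¹)` leaves an element of `Sp^M`. Membership in `U` thus becomes a
condition on the images of the `u_i` alone. -/
lemma U_eq_upperUni : U n K = upperUni n K := by
  refine le_antisymm (sup_le inf_le_right SpPt_le_upperUni) fun g hg => ?_
  obtain ⟨A, hA, -, h⟩ := exists_levi_mul (upperUni_le_SpM hg)
  have hT : levi n K A ∈ T n K := by
    refine ⟨levi_mem_SpMN A, fun _ _ => rfl, fun i j hij => ?_, fun i => ?_⟩
    · exact (congrFun (congrFun hA i) j).trans (hg.2.1 i j hij)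
    · exact (congrFun (congrFun hA i) i).trans (hg.2.2 i)
  have := (U n K).mul_mem ((le_sup_left : T n K ≤ U n K) hT)
    ((le_sup_right : SpPt n K ≤ U n K) h)
  rwa [mul_inv_cancel_left] at this

end Blocks

/-- The position of a basis vector in the order `u_1, …, u_n, v_n, …, v_1`. -/
def ord : Fin n ⊕ Fin n → ℕ := Sum.elim (fun i => i) fun i => 2 * n - 1 - i

lemma ord_injective : Function.Injective (ord (n := n)) := by
  rintro (i | i) (j | j) h <;> simp only [ord, Sum.elim_inl, Sum.elim_inr] at h
  · rw [Fin.ext h]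
  · omega
  · omega
  · rw [Fin.ext (by omega : (i : ℕ) = j)]

/-- The lower right block is the inverse transpose of the upper left one, hence lower unitriangular;
since `ord` runs backwards on the `v_j`, the whole matrix is upper unitriangular in this order. -/
lemma mem_U_iff [Finite K] {g : Sp n K} :
    g ∈ U n K ↔ (∀ a b, ord b < ord a → g.1 a b = 0) ∧ ∀ a, g.1 a a = 1 := by
  rw [U_eq_upperUni]
  constructor
  · intro hg
    obtain ⟨A, hA, hA'⟩ := exists_GL (upperUni_le_SpM hg)
    have hAt : A.1.BlockTriangular id := fun i j hij => by
      rw [hA]; exact hg.2.1 i j hij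
    have hinv : (A⁻¹ : GL (Fin n) K).1.BlockTriangular id := by
      have : Invertible A.1 := A.invertible
      have h := Matrix.blockTriangular_inv_of_blockTriangular hAt
      rwa [← Matrix.coe_units_inv] at h
    have hD : ∀ i j : Fin n, i < j → g.1 (Sum.inr i) (Sum.inr j) = 0 := fun i j hij =>
      (congrFun (congrFun hA' i) j).symm.trans (hinv hij)
    refine ⟨?_, ?_⟩
    · rintro (i | i) (j | j) h <;> simp only [ord, Sum.elim_inl, Sum.elim_inr] at h
      · exact hg.2.1 i j h
      · omega
      · exact hg.1 i j
      · exact hD i j (by rw [Fin.lt_def]; omega)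
    · rintro (i | i)
      · exact hg.2.2 i
      · have h := congrFun (congrFun (toBlocks_transpose_mul (upperUni_le_SpM hg)) i) i
        rw [Matrix.mul_apply, Finset.sum_eq_single i] at h
        · have h1 : g.1.toBlocks₁₁ᵀ i i = 1 := hg.2.2 i
          rw [h1, one_mul, Matrix.one_apply_eq] at h
          exact h
        · intro k _ hk
          rcases lt_or_gt_of_ne hk with h1 | h1
          · have : g.1.toBlocks₂₂ k i = 0 := hD k i h1
            rw [this, mul_zero]
          · have : g.1.toBlocks₁₁ᵀ i k = 0 := hg.2.1 k i h1
            rw [this, zero_mul]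
        · simp
  · rintro ⟨h1, h2⟩
    exact ⟨fun i j => h1 _ _ (by simp only [ord, Sum.elim_inl, Sum.elim_inr]; omega),
      fun i j hij => h1 _ _ hij, fun i => h2 _⟩

/-! ### Monomial elements and the Weyl group -/

/-- The index `i` of a basis vector `u_i` or `v_i`. -/
def idx : Fin n ⊕ Fin n → Fin n := Sum.elim id id

/-- `g` permutes the lines spanned by the basis vectors by `σ`, and the pairs
`{⟨u_i⟩, ⟨v_i⟩}` by `π`. -/
structure IsMono (g : Sp n K) (σ : Equiv.Perm (Fin n ⊕ Fin n)) (π : Equiv.Perm (Fin n)) :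
    Prop where
  entries : ∃ c : Fin n ⊕ Fin n → K, (∀ b, c b ≠ 0) ∧ ∀ a b, g.1 a b = if a = σ b then c b else 0
  idx_apply : ∀ a, idx (σ a) = π (idx a)

namespace IsMono

variable {g h : Sp n K} {σ τ : Equiv.Perm (Fin n ⊕ Fin n)} {π ρ : Equiv.Perm (Fin n)}

lemma one : IsMono (1 : Sp n K) 1 1 :=
  ⟨⟨1, by simp, fun a b => by simp [Matrix.one_apply]; congr⟩, by simp⟩

lemma mul (hg : IsMono g σ π) (hh : IsMono h τ ρ) : IsMono (g * h) (σ * τ) (π * ρ) := by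
  obtain ⟨c, hc, hg1⟩ := hg.entries
  obtain ⟨d, hd, hh1⟩ := hh.entries
  refine ⟨⟨fun b => c (τ b) * d b, fun b => mul_ne_zero (hc _) (hd _), fun a b => ?_⟩, fun a => ?_⟩
  · simp [Matrix.mul_apply, hg1, hh1]
    congr
  · simp [hg.idx_apply, hh.idx_apply]

lemma unique (hg : IsMono g σ π) (hh : IsMono g τ ρ) : σ = τ ∧ π = ρ := by
  obtain ⟨c, hc, hg1⟩ := hg.entries
  obtain ⟨d, hd, hh1⟩ := hh.entries
  have h : σ = τ := by
    ext1 b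
    by_contra hne
    have := hg1 (σ b) b
    rw [hh1, if_neg hne, if_pos rfl] at this
    exact hc b this.symm
  refine ⟨h, ?_⟩
  ext1 i
  have h1 := hg.idx_apply (Sum.inl i)
  have h2 := hh.idx_apply (Sum.inl i)
  rw [← h, h1] at h2
  exact h2

/-- Comparing entries of `g (g⁻¹ x g) = x g` avoids computing `g⁻¹`. Conjugation only relabels
entries by `σ` and rescales them, so vanishing patterns can be read off. -/
lemma conj_apply (hg : IsMono g σ π) : ∃ c : Fin n ⊕ Fin n → K, (∀ b, c b ≠ 0) ∧
    ∀ (x : Sp n K) a b, (g⁻¹ * x * g).1 a b = (c a)⁻¹ * x.1 (σ a) (σ b) * c b := by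
  obtain ⟨c, hc, hg1⟩ := hg.entries
  refine ⟨c, hc, fun x a b => ?_⟩
  have h : (g * (g⁻¹ * x * g)).1 (σ a) b = (x * g).1 (σ a) b := by
    rw [mul_assoc, mul_inv_cancel_left]
  have mul_entry : ∀ (y z : Sp n K) a b, (y * z).1 a b = ∑ k, y.1 a k * z.1 k b :=
    fun y z a b => Matrix.mul_apply
  rw [mul_entry, mul_entry] at h
  simp only [hg1, EmbeddingLike.apply_eq_iff_eq, ite_mul, zero_mul, mul_ite, mul_zero,
    Finset.sum_ite_eq, Finset.sum_ite_eq', Finset.mem_univ, if_true] at h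
  rw [mul_assoc (c a)⁻¹, ← h, inv_mul_cancel_left₀ (hc a)]

/-- Pairs `{u_i, v_i}` go to pairs, so the partner of a line goes to the partner of its image. -/
lemma swap_sum (hg : IsMono g σ π) (a : Fin n ⊕ Fin n) : σ a.swap = (σ a).swap := by
  have h1 := hg.idx_apply a
  have h2 := hg.idx_apply a.swap
  have h3 : idx a.swap = idx a := by cases a <;> rfl
  rw [h3, ← h1] at h2
  have h4 : σ a.swap ≠ σ a := fun h => by
    have := σ.injective h
    cases a <;> simp at this
  generalize σ a.swap = x at *
  generalize σ a = y at *
  rcases x with x | x <;> rcases y with y | y <;> simp_all [idx]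

end IsMono

lemma isMono_permSp (σ : Equiv.Perm (Fin n)) :
    IsMono (permSp K σ) (Equiv.sumCongr σ σ) σ := by
  refine ⟨⟨1, by simp, ?_⟩, by rintro (i | i) <;> rfl⟩
  rintro (a | a) (b | b) <;>
    simp [permSp, Equiv.Perm.permMatrix, PEquiv.toMatrix_apply, Equiv.eq_symm_apply, eq_comm]

lemma isMono_cElt (j : Fin n) :
    IsMono (cElt K j) (Equiv.swap (Sum.inl j) (Sum.inr j)) 1 := by
  refine ⟨⟨fun b => if b = Sum.inr j then -1 else 1, fun b => by beta_reduce; split_ifs <;> simp, ?_⟩, ?_⟩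
  · rintro (a | a) (b | b) <;> by_cases h : b = j <;> by_cases h' : a = b <;>
      simp_all [cElt, Pi.single_apply, Equiv.swap_apply_def]
  · rintro (a | a) <;> by_cases h : a = j <;> simp [idx, Equiv.swap_apply_def, h]

section Weyl

variable [Finite K]

lemma mem_H_iff {g : Sp n K} : g ∈ H n K ↔ IsMono g 1 1 := by
  constructor
  · rintro ⟨-, hu, hv⟩
    have hs : ∀ b, ∃ c : K, act g (Pi.single b 1) = c • Pi.single b 1 := by
      rintro (b | b)
      · exact hu b
      · exact hv b
    choose c hc using hs
    refine ⟨⟨c, fun b h => ?_, fun a b => ?_⟩, fun a => rfl⟩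
    · have h1 := hc b
      rw [h, zero_smul, ← act_zero g] at h1
      have := congrFun (act_injective g h1) b
      simp at this
    · rw [← act_single, hc]
      simp [Pi.single_apply]
      congr
  · rintro ⟨⟨c, hc, hg⟩, -⟩
    have hs : ∀ b, ∃ c : K, act g (Pi.single b 1) = c • Pi.single b 1 := fun b => by
      refine ⟨c b, ?_⟩
      ext a
      rw [act_single, hg]
      simp [Pi.single_apply]
      congr
    exact ⟨⟨mem_SpM_iff.2 fun i j => by simp [hg], mem_SpN_of_block fun i j => by simp [hg]⟩,
      fun i => hs _, fun i => hs _⟩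

lemma conj_mem_H {g h : Sp n K} {σ : Equiv.Perm (Fin n ⊕ Fin n)} {π : Equiv.Perm (Fin n)}
    (hg : IsMono g σ π) (hh : h ∈ H n K) : g⁻¹ * h * g ∈ H n K := by
  obtain ⟨c, hc, h1⟩ := hg.conj_apply
  obtain ⟨⟨d, hd, h2⟩, -⟩ := mem_H_iff.1 hh
  refine mem_H_iff.2 ⟨⟨fun b => d (σ b), fun b => hd _, fun a b => ?_⟩, fun _ => rfl⟩
  rw [h1, h2]
  by_cases hab : a = b
  · subst hab
    simp only [Equiv.Perm.coe_one, id_eq, if_true]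
    rw [mul_comm, mul_inv_cancel_left₀ (hc a)]
  · simp [hab]

lemma exists_isMono {g : Sp n K} (hg : g ∈ W2 n K) : ∃ σ π, IsMono g σ π := by
  let S : Subgroup (Sp n K) := finiteSubgroup {g | ∃ σ π, IsMono g σ π} ⟨1, 1, IsMono.one⟩
    (by rintro a b ⟨σ, π, h⟩ ⟨τ, ρ, h'⟩; exact ⟨_, _, h.mul h'⟩)
  have : W2 n K ≤ S := by
    rw [W2, Subgroup.closure_le]
    rintro _ (⟨i, j, -, rfl⟩ | ⟨j, rfl⟩)
    · exact ⟨_, _, isMono_permSp _⟩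
    · exact ⟨_, _, isMono_cElt _⟩
  exact this hg

/-- The permutation of the lines spanned by the basis vectors that is induced by a monomial
element. -/
def linePerm (g : Sp n K) : Equiv.Perm (Fin n ⊕ Fin n) :=
  open Classical in if h : ∃ σ π, IsMono g σ π then h.choose else 1

/-- The sign of a monomial element. -/
def eps (g : Sp n K) : ℤˣ :=
  open Classical in
  if h : ∃ σ π, IsMono g σ π then Equiv.Perm.sign h.choose * Equiv.Perm.sign h.choose_spec.choose
  else 1

namespace IsMono

variable {g h : Sp n K} {σ τ : Equiv.Perm (Fin n ⊕ Fin n)} {π ρ : Equiv.Perm (Fin n)}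

lemma linePerm_eq (hg : IsMono g σ π) : linePerm g = σ := by
  have h : ∃ σ π, IsMono g σ π := ⟨σ, π, hg⟩
  rw [linePerm, dif_pos h]
  exact (h.choose_spec.choose_spec.unique hg).1

lemma eps_eq (hg : IsMono g σ π) : eps g = Equiv.Perm.sign σ * Equiv.Perm.sign π := by
  have h : ∃ σ π, IsMono g σ π := ⟨σ, π, hg⟩
  have h' := h.choose_spec.choose_spec.unique hg
  rw [eps, dif_pos h, h'.2, h'.1]

end IsMono

lemma eps_mul {g h : Sp n K} (hg : ∃ σ π, IsMono g σ π) (hh : ∃ σ π, IsMono h σ π) :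
    eps (g * h) = eps g * eps h := by
  obtain ⟨σ, π, hg⟩ := hg
  obtain ⟨τ, ρ, hh⟩ := hh
  rw [(hg.mul hh).eps_eq, hg.eps_eq, hh.eps_eq, Equiv.Perm.sign_mul, Equiv.Perm.sign_mul]
  exact mul_mul_mul_comm _ _ _ _

lemma linePerm_mul {g h : Sp n K} (hg : ∃ σ π, IsMono g σ π) (hh : ∃ σ π, IsMono h σ π) :
    linePerm (g * h) = linePerm g * linePerm h := by
  obtain ⟨σ, π, hg⟩ := hg
  obtain ⟨τ, ρ, hh⟩ := hh
  rw [(hg.mul hh).linePerm_eq, hg.linePerm_eq, hh.linePerm_eq]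

lemma eps_of_mem_H {h : Sp n K} (hh : h ∈ H n K) : eps h = 1 := by
  rw [(mem_H_iff.1 hh).eps_eq]; simp

lemma linePerm_of_mem_H {h : Sp n K} (hh : h ∈ H n K) : linePerm h = 1 :=
  (mem_H_iff.1 hh).linePerm_eq

/-- A swap moves four lines in two transpositions, so its sign comes from the permutation of the
pairs; for `c_j` it comes from the permutation of the lines. The product of both signs is therefore
`-1` on every letter. -/
lemma eps_permSp_swap {i j : Fin n} (hij : i ≠ j) : eps (permSp K (Equiv.swap i j)) = -1 := by
  rw [(isMono_permSp _).eps_eq]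
  simp [hij]

lemma eps_cElt (j : Fin n) : eps (cElt K j) = -1 := by
  rw [(isMono_cElt j).eps_eq]
  simp

variable [NeZero n]

lemma permSp_swap_mem_W2 (i j : Fin n) : permSp K (Equiv.swap i j) ∈ W2 n K :=
  permSp_swap_mem (m := ⊤) (fun i j h _ => Subgroup.subset_closure (Or.inl ⟨i, j, h, rfl⟩)) i j
    le_top le_top

lemma cElt_mem_W2 (j : Fin n) : cElt K j ∈ W2 n K := Subgroup.subset_closure (Or.inr ⟨j, rfl⟩)

lemma W2_le_closure_letters : W2 n K ≤ Subgroup.closure (letters n K) := by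
  have hw : ∀ i j, permSp K (Equiv.swap i j) ∈ Subgroup.closure (letters n K) := fun i j =>
    permSp_swap_mem (m := ⊤) (fun i j h _ => Subgroup.subset_closure (Or.inl ⟨i, j, h, rfl⟩)) i j
      le_top le_top
  rw [W2, Subgroup.closure_le]
  rintro _ (⟨i, j, -, rfl⟩ | ⟨j, rfl⟩)
  · exact hw i j
  · have h : cElt K j = permSp K (Equiv.swap j ⊤) * cElt K ⊤ * permSp K (Equiv.swap j ⊤) := by
      refine Sp_ext (fun i => ?_) fun i => ?_
      · rw [act_mul, act_mul, permSp_uVec, cElt_uVec, cElt_uVec]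
        by_cases hi : i = j
        · simp [hi, permSp_vVec]
        · have : Equiv.swap j ⊤ i ≠ ⊤ := fun h => hi ((Equiv.swap j ⊤).injective (by simpa using h))
          simp [hi, this, permSp_uVec]
      · rw [act_mul, act_mul, permSp_vVec, cElt_vVec, cElt_vVec]
        by_cases hi : i = j
        · simp [hi, permSp_uVec, act_neg]
        · have : Equiv.swap j ⊤ i ≠ ⊤ := fun h => hi ((Equiv.swap j ⊤).injective (by simpa using h))
          simp [hi, this, permSp_vVec]
    rw [SetLike.mem_coe, h]
    exact mul_mem (mul_mem (hw _ _) (Subgroup.subset_closure (Or.inr rfl))) (hw _ _)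

/-- In a finite group the generated subgroup is the generated monoid, so inverses of letters are not
needed. -/
lemma exists_word {x : Sp n K} (hx : x ∈ W2 n K) :
    ∃ L : List (Sp n K), (∀ s ∈ L, s ∈ letters n K) ∧ L.prod = x := by
  have h := W2_le_closure_letters hx
  rw [← Subgroup.mem_toSubmonoid, Subgroup.closure_toSubmonoid_of_finite] at h
  exact Submonoid.exists_list_of_mem_closure h

lemma isMono_letters {s : Sp n K} (hs : s ∈ letters n K) : (∃ σ π, IsMono s σ π) ∧ eps s = -1 := by
  rcases hs with ⟨i, j, hij, rfl⟩ | rfl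
  · exact ⟨⟨_, _, isMono_permSp _⟩, eps_permSp_swap fun h => by rw [h] at hij; omega⟩
  · exact ⟨⟨_, _, isMono_cElt _⟩, eps_cElt _⟩

lemma eps_word {L : List (Sp n K)} (hL : ∀ s ∈ L, s ∈ letters n K) :
    (∃ σ π, IsMono L.prod σ π) ∧ eps L.prod = (-1) ^ L.length := by
  induction L with
  | nil => exact ⟨⟨1, 1, IsMono.one⟩, by simpa using eps_of_mem_H (H n K).one_mem⟩
  | cons s L ih =>
    obtain ⟨h1, h2⟩ := isMono_letters (hL s (by simp))
    obtain ⟨h3, h4⟩ := ih fun t ht => hL t (by simp [ht])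
    rw [List.prod_cons, eps_mul h1 h3, h2, h4, List.length_cons, pow_succ']
    obtain ⟨_, _, h1⟩ := h1
    obtain ⟨_, _, h3⟩ := h3
    exact ⟨⟨_, _, h1.mul h3⟩, rfl⟩

/-- The multiplicative sign `eps` is `-1` on the letters and trivial on `H`, so it records the
parity of any word for `xH`. Only parities of lengths matter, and no further theory of the length
function enters. -/
lemma neg_one_pow_weylLength {x : Sp n K} (hx : x ∈ W2 n K) :
    (-1 : ℤˣ) ^ weylLength x = eps x := by
  have hne : {k | ∃ L : List (Sp n K), (∀ s ∈ L, s ∈ letters n K) ∧ L.length = k ∧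
      L.prod⁻¹ * x ∈ H n K}.Nonempty := by
    obtain ⟨L, hL, rfl⟩ := exists_word hx
    exact ⟨_, L, hL, rfl, by rw [inv_mul_cancel]; exact (H n K).one_mem⟩
  obtain ⟨L, hL, h1, h2⟩ := Nat.sInf_mem hne
  obtain ⟨h3, h4⟩ := eps_word hL
  have h5 := eps_mul h3 ⟨_, _, mem_H_iff.1 h2⟩
  rw [mul_inv_cancel_left, eps_of_mem_H h2, mul_one, h4, h1] at h5
  exact h5.symm

end Weyl

/-! ### Root elements and diagonal elements -/

section Roots

variable [Finite K]

/-- The transvection `1 + t E_{ij}` as an invertible matrix. -/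
def transGL (i j : Fin n) (hij : i ≠ j) (t : K) : GL (Fin n) K :=
  ⟨Matrix.transvection i j t, Matrix.transvection i j (-t),
    by rw [Matrix.transvection_mul_transvection_same _ _ hij, add_neg_cancel,
      Matrix.transvection_zero],
    by rw [Matrix.transvection_mul_transvection_same _ _ hij, neg_add_cancel,
      Matrix.transvection_zero]⟩

/-- The element `diag(1 + t E_{ij}, 1 - t E_{ji})` of `Sp`. -/
def root (i j : Fin n) (hij : i ≠ j) (t : K) : Sp n K := levi n K (transGL i j hij t)

lemma root_inl_inl (i j : Fin n) (hij : i ≠ j) (t : K) (a b : Fin n) :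
    (root i j hij t).1 (Sum.inl a) (Sum.inl b) = Matrix.transvection i j t a b := rfl

lemma root_inr_inr (i j : Fin n) (hij : i ≠ j) (t : K) (a b : Fin n) :
    (root i j hij t).1 (Sum.inr a) (Sum.inr b) = Matrix.transvection i j (-t) b a := rfl

lemma root_self (i j : Fin n) (hij : i ≠ j) (t : K) (a : Fin n ⊕ Fin n) :
    (root i j hij t).1 a a = 1 := by
  have h : ∀ (t : K) (a : Fin n), Matrix.transvection i j t a a = 1 := fun t a => by
    have : ¬ (i = a ∧ j = a) := fun h => hij (h.1.trans h.2.symm)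
    simp [Matrix.transvection, this]
  rcases a with a | a
  · rw [root_inl_inl, h]
  · rw [root_inr_inr, h]

lemma root_apply_ne_zero {i j : Fin n} {hij : i ≠ j} {t : K} {a b : Fin n ⊕ Fin n} (hab : a ≠ b)
    (h : (root i j hij t).1 a b ≠ 0) :
    a = Sum.inl i ∧ b = Sum.inl j ∨ a = Sum.inr j ∧ b = Sum.inr i := by
  have key : ∀ (t : K) (a b : Fin n), a ≠ b → Matrix.transvection i j t a b ≠ 0 →
      a = i ∧ b = j := fun t a b hab h => by
    by_contra hne
    refine h ?_
    have : ¬ (i = a ∧ j = b) := fun h => hne ⟨h.1.symm, h.2.symm⟩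
    simp [Matrix.transvection, this, hab]
  rcases a with a | a <;> rcases b with b | b
  · rw [root_inl_inl] at h
    obtain ⟨rfl, rfl⟩ := key t a b (by simpa using hab) h
    exact Or.inl ⟨rfl, rfl⟩
  · exact absurd rfl h
  · exact absurd rfl h
  · rw [root_inr_inr] at h
    obtain ⟨rfl, rfl⟩ := key (-t) b a (by simpa using hab.symm) h
    exact Or.inr ⟨rfl, rfl⟩

lemma root_uVec (i j : Fin n) (hij : i ≠ j) (t : K) (k : Fin n) :
    act (root i j hij t) (uVec k) = if k = j then uVec j + t • uVec i else uVec k := by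
  ext (a | a)
  · rw [act_uVec, root_inl_inl]
    by_cases hk : k = j <;> by_cases ha : a = k <;> by_cases hai : a = i <;>
      simp_all [Matrix.transvection, Matrix.single_apply, uVec, Matrix.one_apply, eq_comm]
  · rw [act_uVec]
    by_cases hk : k = j <;> simp [hk, root, levi, uVec]

lemma root_vVec (i j : Fin n) (hij : i ≠ j) (t : K) (k : Fin n) :
    act (root i j hij t) (vVec k) = if k = i then vVec i - t • vVec j else vVec k := by
  ext (a | a)
  · rw [act_vVec]
    by_cases hk : k = i <;> simp [hk, root, levi, vVec]
  · rw [act_vVec, root_inr_inr]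
    by_cases hk : k = i <;> by_cases ha : a = k <;> by_cases hai : a = j <;>
      simp_all [Matrix.transvection, Matrix.single_apply, vVec, Matrix.one_apply, eq_comm]

lemma root_zero (i j : Fin n) (hij : i ≠ j) : root i j hij (0 : K) = 1 :=
  Sp_ext (fun k => by rw [root_uVec, act_one]; split_ifs with h <;> simp [h])
    fun k => by rw [root_vVec, act_one]; split_ifs with h <;> simp [h]

lemma root_add (i j : Fin n) (hij : i ≠ j) (s t : K) :
    root i j hij (s + t) = root i j hij s * root i j hij t := by
  refine Sp_ext (fun k => ?_) fun k => ?_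
  · rw [act_mul, root_uVec, root_uVec]
    split_ifs with h
    · rw [act_add, act_smul, root_uVec, root_uVec, if_pos rfl, if_neg hij, add_smul, add_assoc]
    · rw [root_uVec, if_neg h]
  · rw [act_mul, root_vVec, root_vVec]
    split_ifs with h
    · rw [act_sub, act_smul, root_vVec, root_vVec, if_pos rfl, if_neg hij.symm, add_smul, sub_sub]
    · rw [root_vVec, if_neg h]

lemma root_mem_U {i j : Fin n} (hij : i < j) (t : K) : root i j hij.ne t ∈ U n K := by
  rw [mem_U_iff]
  refine ⟨fun a b hab => ?_, root_self i j hij.ne t⟩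
  by_contra h
  rcases root_apply_ne_zero (fun h => by rw [h] at hab; omega) h with ⟨rfl, rfl⟩ | ⟨rfl, rfl⟩ <;>
    simp only [ord, Sum.elim_inl, Sum.elim_inr, Fin.lt_def] at hab hij <;> omega

/-- The diagonal element with `u_i ↦ d_i u_i`, `v_i ↦ d_i⁻¹ v_i`. -/
def diagSp (d : Fin n → Kˣ) : Sp n K :=
  levi n K ⟨Matrix.diagonal fun i => (d i : K), Matrix.diagonal fun i => ((d i)⁻¹ : Kˣ),
    by simp [Matrix.diagonal_mul_diagonal], by simp [Matrix.diagonal_mul_diagonal]⟩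

lemma diagSp_uVec (d : Fin n → Kˣ) (k : Fin n) :
    act (diagSp d) (uVec k) = (d k : K) • uVec k := by
  ext (a | a)
  · rw [act_uVec]
    by_cases ha : a = k <;> simp [diagSp, levi, uVec, ha]
  · rw [act_uVec]
    simp [diagSp, levi, uVec]

lemma diagSp_vVec (d : Fin n → Kˣ) (k : Fin n) :
    act (diagSp d) (vVec k) = ((d k)⁻¹ : Kˣ).1 • vVec k := by
  ext (a | a)
  · rw [act_vVec]
    simp [diagSp, levi, vVec]
  · have h : (diagSp d).1 (Sum.inr a) (Sum.inr k) =
        Matrix.diagonal (fun i => (((d i)⁻¹ : Kˣ) : K)) k a := rfl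
    rw [act_vVec, h]
    rcases eq_or_ne a k with rfl | ha
    · simp [vVec]
    · simp [vVec, ha, Matrix.diagonal_apply_ne _ ha.symm]

lemma diagSp_mem_H (d : Fin n → Kˣ) : diagSp d ∈ H n K :=
  ⟨levi_mem_SpMN _, fun i => ⟨_, diagSp_uVec d i⟩, fun i => ⟨_, diagSp_vVec d i⟩⟩

/-- The relation between opposite root elements in rank one. -/
lemma swap_mul_root_mul_swap {i j : Fin n} (hij : i ≠ j) (t : Kˣ) :
    ∃ h ∈ H n K, permSp K (Equiv.swap i j) * root i j hij (t : K) * permSp K (Equiv.swap i j) =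
      root i j hij (t : K)⁻¹ * permSp K (Equiv.swap i j) * h * root i j hij (t : K)⁻¹ := by
  -- On the plane of `u_i`, `u_j` the identity reads `w x(t) w = x(1/t) w diag(t, -1/t) x(1/t)`; the
  -- sign in `d` compensates `det w = -1`.
  let d : Fin n → Kˣ := fun k => if k = i then t else if k = j then -t⁻¹ else 1
  refine ⟨diagSp d, diagSp_mem_H d, Sp_ext (fun k => ?_) fun k => ?_⟩
  · simp only [act_mul, permSp_uVec, root_uVec]
    by_cases hi : k = i
    · subst hi
      simp [act_add, act_smul, permSp_uVec, hij, root_uVec, diagSp_uVec, d, add_comm]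
    · by_cases hj : k = j
      · subst hj
        simp [act_add, act_smul, act_neg, permSp_uVec, hij, hij.symm, root_uVec, diagSp_uVec, d]
      · simp [permSp_uVec, root_uVec, diagSp_uVec, d, hi, hj, Equiv.swap_apply_of_ne_of_ne]
  · simp only [act_mul, permSp_vVec, root_vVec]
    by_cases hi : k = i
    · subst hi
      simp [act_sub, act_add, act_smul, permSp_vVec, hij.symm, root_vVec, diagSp_vVec, d]
    · by_cases hj : k = j
      · subst hj
        simp [act_sub, act_smul, act_neg, permSp_vVec, hij.symm, root_vVec, diagSp_vVec, d,
          smul_sub]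
      · simp [permSp_vVec, root_vVec, diagSp_vVec, d, hi, hj, Equiv.swap_apply_of_ne_of_ne]

lemma ord_swap (a : Fin n ⊕ Fin n) : ord a.swap = 2 * n - 1 - ord a := by
  rcases a with a | a <;> simp only [ord, Sum.swap_inl, Sum.swap_inr, Sum.elim_inl, Sum.elim_inr]
  omega

lemma ord_le (a : Fin n ⊕ Fin n) : ord a ≤ 2 * n - 1 := by
  rcases a with a | a <;> simp only [ord, Sum.elim_inl, Sum.elim_inr] <;> omega

/-- A root element has two off-diagonal entries, at `(u_i, u_j)` and `(v_j, v_i)`. The hypothesis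
puts the first one above the diagonal after conjugation; exchanging `u` and `v` reverses the order
and takes care of the second. -/
lemma conj_root_mem_U {g : Sp n K} {σ : Equiv.Perm (Fin n ⊕ Fin n)} {π : Equiv.Perm (Fin n)}
    (hg : IsMono g σ π) {i j : Fin n} (hij : i ≠ j) (t : K)
    (h : ord (σ.symm (Sum.inl i)) < ord (σ.symm (Sum.inl j))) :
    g⁻¹ * root i j hij t * g ∈ U n K := by
  obtain ⟨c, hc, h1⟩ := hg.conj_apply
  rw [mem_U_iff]
  refine ⟨fun a b hab => ?_, fun a => by rw [h1, root_self, mul_one, inv_mul_cancel₀ (hc a)]⟩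
  by_contra hne
  rw [h1] at hne
  have hab' : a ≠ b := fun h => by rw [h] at hab; omega
  rcases root_apply_ne_zero (σ.injective.ne hab') (right_ne_zero_of_mul (left_ne_zero_of_mul hne))
    with ⟨h2, h3⟩ | ⟨h2, h3⟩
  · rw [← h2, ← h3, Equiv.symm_apply_apply, Equiv.symm_apply_apply] at h
    omega
  · have h4 : σ b.swap = Sum.inl i := by rw [hg.swap_sum, h3]; rfl
    have h5 : σ a.swap = Sum.inl j := by rw [hg.swap_sum, h2]; rfl
    rw [← h4, ← h5, Equiv.symm_apply_apply, Equiv.symm_apply_apply, ord_swap, ord_swap] at h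
    have := ord_le a
    omega

end Roots

/-! ### The Steinberg element -/

section Finsum

variable {ι R A : Type*} [Finite ι]

lemma mul_finsum_of_finite [NonUnitalNonAssocSemiring R] (a : R) (f : ι → R) :
    a * ∑ᶠ i, f i = ∑ᶠ i, a * f i := by
  have := Fintype.ofFinite ι
  rw [finsum_eq_sum_of_fintype, finsum_eq_sum_of_fintype, Finset.mul_sum]

lemma finsum_mul_of_finite [NonUnitalNonAssocSemiring R] (a : R) (f : ι → R) :
    (∑ᶠ i, f i) * a = ∑ᶠ i, f i * a := by
  have := Fintype.ofFinite ι
  rw [finsum_eq_sum_of_fintype, finsum_eq_sum_of_fintype, Finset.sum_mul]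

lemma finsum_sub_of_finite [AddCommGroup A] (f g : ι → A) :
    ∑ᶠ i, (f i - g i) = ∑ᶠ i, f i - ∑ᶠ i, g i := by
  have := Fintype.ofFinite ι
  simp only [finsum_eq_sum_of_fintype, Finset.sum_sub_distrib]

end Finsum

section SteinbergElement

variable [Finite K] (F : Type v) [Field F]

local notation "δ" => MonoidAlgebra.of F (Sp n K)

variable (n K) in
/-- The sum of the elements of `B`. -/
def sumB : F[Sp n K] := ∑ᶠ b : B n K, δ b

lemma of_mul_sumB {b : Sp n K} (hb : b ∈ B n K) : δ b * sumB n K F = sumB n K F := by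
  rw [sumB, mul_finsum_of_finite]
  exact finsum_comp_equiv (f := fun c : B n K => δ c) (Equiv.mulLeft (⟨b, hb⟩ : B n K)) |>.symm ▸
    finsum_congr fun c => by simp

/-- The signed sum over the coset `gB`. -/
def cosetTerm (g : Sp n K) : F[Sp n K] := ((eps g : ℤ) : F) • (δ g * sumB n K F)

variable {F}

lemma H_le_B : H n K ≤ B n K := le_sup_right

lemma U_le_B : U n K ≤ B n K := le_sup_left

lemma of_mul_cosetTerm {w g : Sp n K} (hw : ∃ σ π, IsMono w σ π) (hg : ∃ σ π, IsMono g σ π) :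
    δ w * cosetTerm F g = ((eps w : ℤ) : F) • cosetTerm F (w * g) := by
  rw [cosetTerm, cosetTerm, eps_mul hw hg, smul_smul, mul_smul_comm, ← mul_assoc, ← map_mul,
    ← Int.cast_mul, ← Units.val_mul, ← mul_assoc, Int.units_mul_self, one_mul]

lemma cosetTerm_mul_H {g h : Sp n K} (hg : ∃ σ π, IsMono g σ π) (hh : h ∈ H n K) :
    cosetTerm F (g * h) = cosetTerm F g := by
  rw [cosetTerm, cosetTerm, eps_mul hg ⟨_, _, mem_H_iff.1 hh⟩, eps_of_mem_H hh, mul_one, map_mul,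
    mul_assoc, of_mul_sumB F (H_le_B hh)]

/-- The reason is `x g B = g B`. -/
lemma of_mul_cosetTerm_of_conj {x g : Sp n K} (h : g⁻¹ * x * g ∈ B n K) :
    δ x * cosetTerm F g = cosetTerm F g := by
  rw [cosetTerm, mul_smul_comm, ← mul_assoc, ← map_mul,
    show x * g = g * (g⁻¹ * x * g) by group, map_mul, mul_assoc, of_mul_sumB F h]

section WeylRep

lemma weylRep_mem (c : Weyl n K) : weylRep c ∈ W2 n K := (Quotient.out c).2

lemma exists_isMono_weylRep (c : Weyl n K) : ∃ σ π, IsMono (weylRep c) σ π :=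
  exists_isMono (weylRep_mem c)

lemma exists_weylRep_mk (w : W2 n K) :
    ∃ h ∈ H n K, weylRep (QuotientGroup.mk w : Weyl n K) = w * h := by
  obtain ⟨h, hh⟩ := QuotientGroup.mk_out_eq_mul ((H n K).subgroupOf (W2 n K)) w
  exact ⟨h.1.1, h.2, congrArg Subtype.val hh⟩

instance : MulAction (W2 n K) (Weyl n K) :=
  MulAction.quotient (W2 n K) ((H n K).subgroupOf (W2 n K))

/-- The chosen representatives are not multiplicative; the defect lies in `H` and is absorbed by the
sum over `B`. -/
lemma exists_weylRep_smul (w : W2 n K) (c : Weyl n K) :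
    ∃ h ∈ H n K, weylRep (w • c) = w * weylRep c * h := by
  have h1 : w • c = (QuotientGroup.mk (w * Quotient.out c) : Weyl n K) := by
    conv_lhs => rw [← QuotientGroup.out_eq' c]
    rfl
  obtain ⟨h, hh, h2⟩ := exists_weylRep_mk (w * Quotient.out c)
  exact ⟨h, hh, by rw [h1, h2]; rfl⟩

end WeylRep

lemma of_mul_cosetTerm_weylRep (w : W2 n K) (c : Weyl n K) :
    δ w * cosetTerm F (weylRep c) = ((eps w.1 : ℤ) : F) • cosetTerm F (weylRep (w • c)) := by
  obtain ⟨h, hh, h1⟩ := exists_weylRep_smul w c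
  have hw := exists_isMono w.2
  have hc := exists_isMono_weylRep c
  have hwc : ∃ σ π, IsMono (w.1 * weylRep c) σ π := exists_isMono (mul_mem w.2 (weylRep_mem c))
  rw [of_mul_cosetTerm hw hc, h1, cosetTerm_mul_H hwc hh]

variable [NeZero n]

variable (F) in
lemma eSt_eq : eSt n K F = ∑ᶠ c : Weyl n K, cosetTerm F (weylRep c) := by
  rw [eSt, finsum_mul_of_finite]
  refine finsum_congr fun c => ?_
  rw [cosetTerm, ← neg_one_pow_weylLength (weylRep_mem c), smul_mul_assoc]
  simp [sumB]

lemma of_mul_eSt_of_mem_H {h : Sp n K} (hh : h ∈ H n K) : δ h * eSt n K F = eSt n K F := by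
  rw [eSt_eq, mul_finsum_of_finite]
  refine finsum_congr fun c => of_mul_cosetTerm_of_conj (H_le_B ?_)
  obtain ⟨σ, π, hc⟩ := exists_isMono_weylRep c
  exact conj_mem_H hc hh

/-- Steinberg's element as `y - w y`, where `w` interchanges `i` and `j` and `y` is fixed by
the root elements for `(i, j)`. -/
lemma exists_half_sum {i j : Fin n} (hij : i ≠ j) :
    ∃ y : F[Sp n K], eSt n K F = y - δ (permSp K (Equiv.swap i j)) * y ∧
      (∀ t : K, δ (root i j hij t) * y = y) ∧ ∀ h ∈ H n K, δ h * y = y := by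
  classical
  let w : W2 n K := ⟨permSp K (Equiv.swap i j), permSp_swap_mem_W2 i j⟩
  -- `P c` says that the root `(i, j)` is still positive after conjugation by `n_c`. The reflection
  -- `w` exchanges the cosets with and without this property and reverses their signs, so `y` is the
  -- part of `e` where `P` holds.
  let P : Weyl n K → Prop := fun c =>
    ord ((linePerm (weylRep c)).symm (Sum.inl i)) < ord ((linePerm (weylRep c)).symm (Sum.inl j))
  have hP : ∀ c, P (w • c) ↔ ¬ P c := fun c => by
    obtain ⟨h, hh, h1⟩ := exists_weylRep_smul w c
    have hw := exists_isMono w.2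
    have hc := exists_isMono_weylRep c
    have hwc : ∃ σ π, IsMono (w.1 * weylRep c) σ π := exists_isMono (mul_mem w.2 (weylRep_mem c))
    have h2 : linePerm (weylRep (w • c)) =
        Equiv.sumCongr (Equiv.swap i j) (Equiv.swap i j) * linePerm (weylRep c) := by
      rw [h1, linePerm_mul hwc ⟨_, _, mem_H_iff.1 hh⟩, linePerm_of_mem_H hh, mul_one,
        linePerm_mul hw hc, (isMono_permSp _).linePerm_eq]
    have h3 : ∀ a, (linePerm (weylRep (w • c))).symm a = (linePerm (weylRep c)).symm
        ((Equiv.sumCongr (Equiv.swap i j) (Equiv.swap i j)).symm a) := fun a => by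
      rw [h2]; rfl
    have h4 : ord ((linePerm (weylRep c)).symm (Sum.inl i)) ≠
        ord ((linePerm (weylRep c)).symm (Sum.inl j)) := fun h =>
      hij (Sum.inl_injective ((linePerm (weylRep c)).symm.injective (ord_injective h)))
    simp only [P, h3, Equiv.sumCongr_symm, Equiv.sumCongr_apply, Sum.map_inl, Equiv.symm_swap,
      Equiv.swap_apply_left, Equiv.swap_apply_right]
    omega
  have hww : ∀ c : Weyl n K, w • w • c = c := fun c => by
    rw [smul_smul, show w * w = 1 from Subtype.ext (permSp_swap_mul_self i j), one_smul]
  let e : Equiv.Perm (Weyl n K) := ⟨(w • ·), (w • ·), hww, hww⟩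
  refine ⟨∑ᶠ c, if P c then cosetTerm F (weylRep c) else 0, ?_, fun t => ?_, fun h hh => ?_⟩
  · rw [mul_finsum_of_finite, ← finsum_comp_equiv e (f := fun c => δ (permSp K (Equiv.swap i j)) *
      if P c then cosetTerm F (weylRep c) else 0), ← finsum_sub_of_finite, eSt_eq]
    refine finsum_congr fun c => ?_
    have h1 := of_mul_cosetTerm_weylRep (F := F) w (w • c)
    rw [hww, eps_permSp_swap hij] at h1
    have h2 : e c = w • c := rfl
    by_cases hc : P c
    · simp [h2, hP, hc]
    · simp only [h2, hP, hc, not_false_iff, if_true, if_false]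
      rw [h1]
      simp
  · rw [mul_finsum_of_finite]
    refine finsum_congr fun c => ?_
    split_ifs with hc
    · obtain ⟨σ, π, hm⟩ := exists_isMono_weylRep c
      refine of_mul_cosetTerm_of_conj (U_le_B (conj_root_mem_U hm hij t ?_))
      rwa [← hm.linePerm_eq]
    · rw [mul_zero]
  · rw [mul_finsum_of_finite]
    refine finsum_congr fun c => ?_
    split_ifs with hc
    · obtain ⟨σ, π, hm⟩ := exists_isMono_weylRep c
      exact of_mul_cosetTerm_of_conj (H_le_B (conj_mem_H hm hh))
    · rw [mul_zero]

/-- Steinberg's relation. -/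
lemma swap_mul_root_mul_eSt {i j : Fin n} (hij : i ≠ j) (t : Kˣ) :
    δ (permSp K (Equiv.swap i j)) * (δ (root i j hij (t : K)) * eSt n K F) =
      δ (root i j hij (t : K)⁻¹) * eSt n K F - eSt n K F := by
  obtain ⟨y, hy, h1, h2⟩ := exists_half_sum (K := K) (F := F) hij
  obtain ⟨h, hh, h3⟩ := swap_mul_root_mul_swap hij t
  have h4 : δ (permSp K (Equiv.swap i j)) * (δ (root i j hij (t : K)) *
      (δ (permSp K (Equiv.swap i j)) * y)) =
      δ (root i j hij (t : K)⁻¹) * (δ (permSp K (Equiv.swap i j)) * y) := by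
    rw [← mul_assoc, ← mul_assoc, ← map_mul, ← map_mul, h3, map_mul, map_mul, map_mul, mul_assoc,
      h1, mul_assoc, h2 h hh, mul_assoc]
  -- With `e = y - w y` both sides equal `w y - x(1/t) w y`.
  rw [hy, mul_sub, mul_sub, h1, h4, mul_sub, h1]
  abel

lemma swap_mul_eSt {i j : Fin n} (hij : i ≠ j) :
    δ (permSp K (Equiv.swap i j)) * eSt n K F = -eSt n K F := by
  obtain ⟨y, hy, -, -⟩ := exists_half_sum (K := K) (F := F) hij
  rw [hy, mul_sub, ← mul_assoc, ← map_mul, permSp_swap_mul_self, map_one, one_mul]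
  abel

/-- If `q = -1` in `F`, then the sum over a root subgroup of the translates of `e` is fixed by
the corresponding reflection. -/
lemma swap_mul_sum_root {i j : Fin n} (hij : i ≠ j) (hq : ((Nat.card K : ℕ) : F) + 1 = 0) :
    δ (permSp K (Equiv.swap i j)) * ∑ᶠ t : K, δ (root i j hij t) * eSt n K F =
      ∑ᶠ t : K, δ (root i j hij t) * eSt n K F := by
  classical
  have := Fintype.ofFinite K
  -- With the convention `0⁻¹ = 0`, inversion permutes all of `K`, and the extra `-e` at `t = 0`
  -- turns the value `0` of the generic formula into `w e = -e`. Summation then gives `z - q e - e`.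
  have key : ∀ t : K, δ (permSp K (Equiv.swap i j)) * (δ (root i j hij t) * eSt n K F) =
      δ (root i j hij t⁻¹) * eSt n K F - eSt n K F - if t = 0 then eSt n K F else 0 := fun t => by
    by_cases ht : t = 0
    · subst ht
      rw [_root_.inv_zero, root_zero, map_one, one_mul, swap_mul_eSt hij, if_pos rfl, sub_self, zero_sub]
    · have := swap_mul_root_mul_eSt (F := F) hij (Units.mk0 t ht)
      simpa [ht] using this
  rw [mul_finsum_of_finite, finsum_congr key, finsum_sub_of_finite, finsum_sub_of_finite,
    show ∑ᶠ t : K, δ (root i j hij t⁻¹) * eSt n K F = ∑ᶠ t : K, δ (root i j hij t) * eSt n K F from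
      finsum_comp_equiv (Equiv.inv K) (f := fun t => δ (root i j hij t) * eSt n K F),
    finsum_eq_sum_of_fintype fun _ : K => eSt n K F,
    finsum_eq_sum_of_fintype fun t : K => if t = 0 then eSt n K F else 0, Finset.sum_const,
    Finset.card_univ, ← Nat.card_eq_fintype_card, Finset.sum_ite_eq' Finset.univ, sub_sub,
    if_pos (Finset.mem_univ _), ← Nat.cast_smul_eq_nsmul F]
  rw [show ((Nat.card K : ℕ) : F) • eSt n K F + eSt n K F =
    (((Nat.card K : ℕ) : F) + 1) • eSt n K F by rw [add_smul, one_smul], hq, zero_smul, sub_zero]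

end SteinbergElement

/-! ### The vector `e_χ` for `χ = χ_{v_n}` -/

/-- The exponent of the cocycle that defines `XRep`. -/
def coc (g : Sp n K) (x : Fin n → K) : K := form (act g (ofN x)) (ofN (actN g x))

section Cocycle

variable [Finite K]

lemma coc_mul {g : Sp n K} (hg : g ∈ SpM n K) (h : Sp n K) (x : Fin n → K) :
    coc (g * h) x = coc h x + coc g (actN h x) := form_cocycle hg h x

lemma coc_neg (g : Sp n K) (x : Fin n → K) : coc g (-x) = coc g x := by
  rw [coc, coc, actN_neg, ofN_neg, ofN_neg, act_neg, form_neg_neg]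

lemma ofN_single (i : Fin n) (c : K) : (ofN (Pi.single i c) : V n K) = c • vVec i := by
  ext (j | j)
  · simp [ofN, vVec]
  · by_cases h : j = i
    · subst h; simp [ofN, vVec]
    · simp [ofN, vVec, h]

lemma actN_single (g : Sp n K) (i : Fin n) (c : K) (j : Fin n) :
    actN g (Pi.single i c) j = c * g.1 (Sum.inr j) (Sum.inr i) := by
  rw [actN, ofN_single, act_smul]
  simp [projN, act_vVec]

lemma coc_eq_zero_of_act {g : Sp n K} {x y : Fin n → K} (h : act g (ofN x) = ofN y) :
    coc g x = 0 := by
  rw [coc, h, form_N]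

variable [NeZero n]

variable (n K) in
/-- The coordinates of `v_n`. -/
def vLast : Fin n → K := Pi.single ⊤ 1

lemma ofN_vLast : (ofN (vLast n K) : V n K) = vVec ⊤ := by
  rw [vLast, ofN_single, one_smul]

lemma actN_vLast (g : Sp n K) (j : Fin n) : actN g (vLast n K) j = g.1 (Sum.inr j) (Sum.inr ⊤) := by
  rw [vLast, actN_single, one_mul]

lemma actN_vLast_of_mem_U {g : Sp n K} (hg : g ∈ U n K) : actN g (vLast n K) = vLast n K := by
  rw [mem_U_iff] at hg
  ext j
  rw [actN_vLast]
  by_cases hj : j = ⊤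
  · subst hj
    rw [hg.2, vLast, Pi.single_eq_same]
  · rw [hg.1, vLast, Pi.single_eq_of_ne hj]
    have : j < ⊤ := lt_top_iff_ne_top.2 hj
    simp only [ord, Sum.elim_inr]
    rw [Fin.lt_def] at this
    omega

lemma U_le_SpM : U n K ≤ SpM n K := U_eq_upperUni (n := n) (K := K) ▸ upperUni_le_SpM

lemma H_le_SpM : H n K ≤ SpM n K := fun _ hg => hg.1.1

variable {F : Type v} [Field F]

lemma chi_eq_of_actN {lam : AddChar K F} {g : Sp n K} (hg : actN g (vLast n K) = vLast n K) :
    chi lam (vVec ⊤) g = lam (coc g (vLast n K)) := by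
  rw [chi, coc, hg, ofN_vLast]

/-- `U` fixes `v_n` modulo `M`, and on the stabilizer of a vector of `V / M` the cocycle is a
homomorphism. -/
lemma chi_mul_of_mem_U (lam : AddChar K F) {g h : Sp n K} (hg : g ∈ U n K) (hh : h ∈ U n K) :
    chi lam (vVec ⊤) (g * h) = chi lam (vVec ⊤) g * chi lam (vVec ⊤) h := by
  rw [chi_eq_of_actN (actN_vLast_of_mem_U (mul_mem hg hh)),
    chi_eq_of_actN (actN_vLast_of_mem_U hg), chi_eq_of_actN (actN_vLast_of_mem_U hh),
    coc_mul (U_le_SpM hg), actN_vLast_of_mem_U hh, AddChar.map_add_eq_mul, mul_comm]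

lemma chi_ne_zero (lam : AddChar K F) (x : V n K) (g : Sp n K) : chi lam x g ≠ 0 := by
  intro h
  have := lam.map_add_eq_mul (form (act g x) x) (-form (act g x) x)
  rw [chi] at h
  rw [add_neg_cancel, AddChar.map_zero_eq_one, h, zero_mul] at this
  exact one_ne_zero this

lemma chi_conj (lam : AddChar K F) (x : V n K) (g u : Sp n K) :
    chi lam x (g⁻¹ * u * g) = chi lam (act g x) u := by
  rw [chi, chi, ← form_act g, ← act_mul, mul_assoc, mul_inv_cancel_left, act_mul]

end Cocycle

/-! ### The action of `U`, `H` and the reflections on `e_χ` -/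

section Eigenvector

variable [Finite K] [NeZero n] {F : Type v} [Field F]

local notation "δ" => MonoidAlgebra.of F (Sp n K)

lemma of_mul_eChar_of_mem_U (lam : AddChar K F) {g : Sp n K} (hg : g ∈ U n K) :
    δ g * eChar (chi lam (vVec ⊤)) = chi lam (vVec ⊤) g • eChar (chi lam (vVec ⊤)) := by
  rw [eChar, mul_finsum_of_finite, smul_finsum,
    ← finsum_comp_equiv (Equiv.mulLeft (⟨g, hg⟩ : U n K)) (f := fun u : U n K =>
      chi lam (vVec ⊤) g • (chi lam (vVec ⊤) u.1)⁻¹ • (δ u * eSt n K F))]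
  refine finsum_congr fun u => ?_
  rw [Equiv.coe_mulLeft, Subgroup.coe_mul, chi_mul_of_mem_U lam hg u.2, smul_smul, mul_inv,
    mul_inv_cancel_left₀ (chi_ne_zero _ _ _), map_mul, mul_smul_comm, mul_assoc]

lemma conj_mem_U_of_mem_H {h u : Sp n K} (hh : h ∈ H n K) (hu : u ∈ U n K) :
    h⁻¹ * u * h ∈ U n K := by
  obtain ⟨c, hc, h1⟩ := (mem_H_iff.1 hh).conj_apply
  rw [mem_U_iff] at hu ⊢
  refine ⟨fun a b hab => ?_, fun a => ?_⟩
  · rw [h1, Equiv.Perm.one_apply, Equiv.Perm.one_apply, hu.1 a b hab, mul_zero, zero_mul]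
  · rw [h1, Equiv.Perm.one_apply, hu.2, mul_one, inv_mul_cancel₀ (hc a)]

lemma of_mul_eChar_of_mem_H (lam : AddChar K F) (x : V n K) {h : Sp n K} (hh : h ∈ H n K) :
    δ h * eChar (chi lam x) = eChar (chi lam (act h x)) := by
  let e : U n K ≃ U n K :=
    { toFun := fun u => ⟨h⁻¹⁻¹ * u * h⁻¹, conj_mem_U_of_mem_H (inv_mem hh) u.2⟩
      invFun := fun u => ⟨h⁻¹ * u * h, conj_mem_U_of_mem_H hh u.2⟩
      left_inv := fun u => Subtype.ext (by simp [mul_assoc])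
      right_inv := fun u => Subtype.ext (by simp [mul_assoc]) }
  rw [eChar, eChar, mul_finsum_of_finite, ← finsum_comp_equiv e
    (f := fun u : U n K => (chi lam (act h x) u.1)⁻¹ • (δ u.1 * eSt n K F))]
  refine finsum_congr fun u => ?_
  have h1 : (e u).1 = h * u * h⁻¹ := by simp [e]
  have h2 : h⁻¹ * (h * u * h⁻¹) * h = u.1 := by group
  have h3 : δ (h * u.1 * h⁻¹) * eSt n K F = δ h * (δ u.1 * eSt n K F) := by
    rw [map_mul, map_mul, mul_assoc, of_mul_eSt_of_mem_H (inv_mem hh), mul_assoc]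
  rw [h1, ← chi_conj, h2, h3, mul_smul_comm]

/-- The elements of `U` with vanishing `(u_i, u_j)` entry. -/
abbrev UZero (n : ℕ) (K : Type u) [Field K] [Finite K] (i j : Fin n) : Type u :=
  {g : Sp n K // g ∈ U n K ∧ g.1 (Sum.inl i) (Sum.inl j) = 0}

lemma mul_root_apply {g : Sp n K} (hg : g ∈ U n K) {i j : Fin n} (hij : i ≠ j) (t : K) :
    (g * root i j hij t).1 (Sum.inl i) (Sum.inl j) = g.1 (Sum.inl i) (Sum.inl j) + t := by
  rw [← act_uVec, act_mul, root_uVec, if_pos rfl, act_add, act_smul, Pi.add_apply, Pi.smul_apply,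
    act_uVec, act_uVec, (mem_U_iff.1 hg).2, smul_eq_mul, mul_one]

/-- The factorization of `U` along the root subgroup for `(i, j)`. -/
def unipotentEquiv {i j : Fin n} (hij : i < j) : UZero n K i j × K ≃ U n K where
  toFun p := ⟨p.1.1 * root i j hij.ne p.2, mul_mem p.1.2.1 (root_mem_U hij _)⟩
  invFun g := (⟨g.1 * root i j hij.ne (-g.1.1 (Sum.inl i) (Sum.inl j)),
    mul_mem g.2 (root_mem_U hij _), by rw [mul_root_apply g.2, add_neg_cancel]⟩,
    g.1.1 (Sum.inl i) (Sum.inl j))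
  left_inv p := by
    have h := mul_root_apply p.1.2.1 hij.ne p.2
    rw [p.1.2.2, zero_add] at h
    refine Prod.ext (Subtype.ext ?_) h
    dsimp only
    rw [h, mul_assoc, ← root_add, add_neg_cancel, root_zero, mul_one]
  right_inv g := Subtype.ext (by
    dsimp only
    rw [mul_assoc, ← root_add, neg_add_cancel, root_zero, mul_one])

/-- A simple reflection permutes the positive roots other than its own; this is why `i` and `j` must
be adjacent. -/
lemma conj_mem_UZero {i j : Fin n} (hij : i.val + 1 = j.val) {g : Sp n K} (hg : g ∈ U n K)
    (h0 : g.1 (Sum.inl i) (Sum.inl j) = 0) :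
    permSp K (Equiv.swap i j) * g * permSp K (Equiv.swap i j) ∈ U n K ∧
      (permSp K (Equiv.swap i j) * g * permSp K (Equiv.swap i j)).1 (Sum.inl i) (Sum.inl j) = 0 := by
  have h1 := (isMono_permSp (K := K) (Equiv.swap i j)).conj_apply
  rw [permSp_swap_inv] at h1
  obtain ⟨c, hc, h1⟩ := h1
  rw [U_eq_upperUni] at hg ⊢
  have hlt : i < j := by rw [Fin.lt_def]; omega
  refine ⟨⟨fun a b => ?_, fun a b hab => ?_, fun a => ?_⟩, ?_⟩
  · rw [h1, Equiv.sumCongr_apply, Equiv.sumCongr_apply, Sum.map_inr, Sum.map_inl, hg.1, mul_zero,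
      zero_mul]
  · rw [h1, Equiv.sumCongr_apply, Equiv.sumCongr_apply, Sum.map_inl, Sum.map_inl]
    have : g.1 (Sum.inl (Equiv.swap i j a)) (Sum.inl (Equiv.swap i j b)) = 0 := by
      -- Interchanging neighbours preserves the order of every pair of indices except the pair
      -- itself, whose entry vanishes by `h0`.
      by_cases h : b = i ∧ a = j
      · rw [h.1, h.2, Equiv.swap_apply_left, Equiv.swap_apply_right, h0]
      · refine hg.2.1 _ _ ?_
        simp only [Equiv.swap_apply_def]
        rw [Fin.lt_def] at hab
        simp only [Fin.ext_iff] at h ⊢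
        split_ifs <;> rw [Fin.lt_def] <;> omega
    rw [this, mul_zero, zero_mul]
  · rw [h1, Equiv.sumCongr_apply, Sum.map_inl, hg.2.2, mul_one, inv_mul_cancel₀ (hc _)]
  · rw [h1, Equiv.sumCongr_apply, Equiv.sumCongr_apply, Sum.map_inl, Sum.map_inl,
      Equiv.swap_apply_left,
      Equiv.swap_apply_right, hg.2.1 _ _ hlt, mul_zero, zero_mul]

/-- If `q = -1` in `F`, then `e_χ` is fixed by the reflections that fix `v_n`. -/
lemma swap_mul_eChar (lam : AddChar K F) (hq : ((Nat.card K : ℕ) : F) + 1 = 0) {i j : Fin n}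
    (hij : i.val + 1 = j.val) (hj : j ≠ ⊤) :
    δ (permSp K (Equiv.swap i j)) * eChar (chi lam (vVec ⊤)) = eChar (chi lam (vVec ⊤)) := by
  have hlt : i < j := by rw [Fin.lt_def]; omega
  have hi : (⊤ : Fin n) ≠ i := fun h => absurd (le_top : j ≤ ⊤) (by rw [h]; exact hlt.not_ge)
  set w := permSp K (Equiv.swap i j) with hw
  set z : F[Sp n K] := ∑ᶠ t : K, δ (root i j hlt.ne t) * eSt n K F with hz
  have hwz : δ w * z = z := swap_mul_sum_root hlt.ne hq
  have hww : w * w = 1 := permSp_swap_mul_self i j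
  have hroot : ∀ t, chi lam (vVec ⊤) (root i j hlt.ne t) = 1 := fun t => by
    rw [chi, root_vVec, if_neg hi, ← ofN_vLast, form_N, AddChar.map_zero_eq_one]
  -- Factoring `U` along the root subgroup, on which `χ` is trivial, collects the terms into copies
  -- of `z`.
  have hsum : (eChar (chi lam (vVec ⊤)) : F[Sp n K]) =
      ∑ᶠ u : UZero n K i j, (chi lam (vVec ⊤) u.1)⁻¹ • (δ u.1 * z) := by
    have := Fintype.ofFinite K
    have := Fintype.ofFinite (UZero n K i j)
    rw [eChar, ← finsum_comp_equiv (unipotentEquiv hlt), finsum_eq_sum_of_fintype,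
      finsum_eq_sum_of_fintype, Fintype.sum_prod_type]
    refine Finset.sum_congr rfl fun u _ => ?_
    rw [hz, finsum_eq_sum_of_fintype, Finset.mul_sum, Finset.smul_sum]
    refine Finset.sum_congr rfl fun t _ => ?_
    change (chi lam (vVec ⊤) (u.1 * root i j hlt.ne t))⁻¹ •
      (δ (u.1 * root i j hlt.ne t) * eSt n K F) = _
    rw [chi_mul_of_mem_U lam u.2.1 (root_mem_U hlt t), hroot, mul_one, map_mul, mul_assoc]
  have hcancel : ∀ u : Sp n K, w * (w * u * w) * w = u := fun u => by
    rw [← mul_assoc, ← mul_assoc, hww, one_mul, mul_assoc, hww, mul_one]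
  let e : UZero n K i j ≃ UZero n K i j :=
    { toFun := fun u => ⟨w * u.1 * w, conj_mem_UZero hij u.2.1 u.2.2⟩
      invFun := fun u => ⟨w * u.1 * w, conj_mem_UZero hij u.2.1 u.2.2⟩
      left_inv := fun u => Subtype.ext (hcancel u.1)
      right_inv := fun u => Subtype.ext (hcancel u.1) }
  rw [hsum, mul_finsum_of_finite, ← finsum_comp_equiv e
    (f := fun u : UZero n K i j => (chi lam (vVec ⊤) u.1)⁻¹ • (δ u.1 * z))]
  refine finsum_congr fun u => ?_
  have h1 : (e u).1 = w * u.1 * w := rfl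
  have h2 : chi lam (vVec ⊤) (w * u.1 * w) = chi lam (vVec ⊤) u.1 := by
    have h3 := chi_conj lam (vVec ⊤) w u.1
    rwa [hw, permSp_swap_inv, permSp_vVec, Equiv.swap_apply_of_ne_of_ne hi hj.symm, ← hw] at h3
  have h4 : δ (w * u.1 * w) * z = δ w * (δ u.1 * z) := by
    rw [map_mul, map_mul, mul_assoc, mul_assoc, hwz]
  rw [h1, h2, h4, mul_smul_comm]

/-! ### The vector `e_χ` is not zero -/

lemma mem_B_ord {b : Sp n K} (hb : b ∈ B n K) : ∀ x y, ord y < ord x → b.1 x y = 0 := by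
  let S : Subgroup (Sp n K) := finiteSubgroup {g | ∀ x y, ord y < ord x → g.1 x y = 0}
    (fun x y h => by
      have : x ≠ y := fun h' => by rw [h'] at h; omega
      simp [this])
    (fun a b ha hb x y h => by
      have mul_entry : (a * b).1 x y = ∑ k, a.1 x k * b.1 k y := Matrix.mul_apply
      rw [mul_entry]
      refine Finset.sum_eq_zero fun k _ => ?_
      rcases lt_or_ge (ord k) (ord x) with h' | h'
      · rw [ha _ _ h', zero_mul]
      · rw [hb _ _ (h.trans_le h'), mul_zero])
  have h : B n K ≤ S := by
    refine sup_le (fun g hg => (mem_U_iff.1 hg).1) fun g hg x y hxy => ?_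
    obtain ⟨⟨c, -, h⟩, -⟩ := mem_H_iff.1 hg
    rw [h, if_neg fun h' => by rw [h'] at hxy; exact lt_irrefl _ hxy]
  exact h hb

/-- A permutation preserves the total of all positions, so no position can drop strictly. -/
lemma perm_eq_one_of_ord_le {σ : Equiv.Perm (Fin n ⊕ Fin n)} (h : ∀ a, ord (σ a) ≤ ord a) :
    σ = 1 := by
  have h1 : ∑ a, ord (σ a) = ∑ a : Fin n ⊕ Fin n, ord a := Equiv.sum_comp σ ord
  have h2 := (Finset.sum_eq_sum_iff_of_le fun a _ => h a).1 h1
  ext1 a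
  exact ord_injective (h2 a (Finset.mem_univ a))

variable (n K) in
/-- The longest element of the Weyl group is represented in `W_2`. -/
lemma exists_longest : ∃ g ∈ W2 n K, ∃ σ π, IsMono g σ π ∧ ∀ a, σ a = a.swap := by
  -- The product of the `c_j`, `j ∈ s`, exchanges the lines of `u_j` and `v_j` exactly for `j ∈ s`.
  have key : ∀ s : Finset (Fin n), ∃ g ∈ W2 n K, ∃ σ π, IsMono g σ π ∧
      ∀ a, σ a = if idx a ∈ s then a.swap else a := by
    intro s
    induction s using Finset.induction_on with
    | empty => exact ⟨1, one_mem _, 1, 1, IsMono.one, by simp⟩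
    | insert j s hj ih =>
      obtain ⟨g, hg, σ, π, h, hσ⟩ := ih
      refine ⟨_, mul_mem (cElt_mem_W2 j) hg, _, _, (isMono_cElt j).mul h, fun a => ?_⟩
      rw [Equiv.Perm.mul_apply, hσ]
      rcases a with a | a <;> by_cases h1 : a = j <;> by_cases h2 : a ∈ s <;>
        simp_all [idx, Equiv.swap_apply_def]
  obtain ⟨g, hg, σ, π, h, hσ⟩ := key Finset.univ
  exact ⟨g, hg, σ, π, h, fun a => by rw [hσ, if_pos (Finset.mem_univ _)]⟩

/-- The big cell: `u w₀ ∈ n B` with `u` in `U` and `n` monomial forces `u = 1` and `n ∈ w₀ H`. -/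
lemma eq_one_of_longest {w g u : Sp n K} {σ τ : Equiv.Perm (Fin n ⊕ Fin n)}
    {π ρ : Equiv.Perm (Fin n)} (hw : IsMono w σ π) (hσ : ∀ a, σ a = a.swap) (hg : IsMono g τ ρ)
    (hu : u ∈ U n K) (hb : g⁻¹ * (u * w) ∈ B n K) : u = 1 ∧ g⁻¹ * w ∈ H n K := by
  obtain ⟨c, hc, hg1⟩ := hg.entries
  obtain ⟨d, hd, hw1⟩ := hw.entries
  have h1 := mem_B_ord hb
  have mul_entry : ∀ (y z : Sp n K) a b, (y * z).1 a b = ∑ k, y.1 a k * z.1 k b :=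
    fun y z a b => Matrix.mul_apply
  -- Comparing entries of `g b = u w` carries the upper triangularity of `b = g⁻¹ u w` over to `u`,
  -- with rows and columns relabelled.
  have key : ∀ x y, ord y < ord x → u.1 (τ x) (σ y) = 0 := fun x y hxy => by
    have h : (g * (g⁻¹ * (u * w))).1 (τ x) y = (u * w).1 (τ x) y := by rw [mul_inv_cancel_left]
    rw [mul_entry, mul_entry] at h
    simp only [hg1, hw1, EmbeddingLike.apply_eq_iff_eq, ite_mul, zero_mul, mul_ite, mul_zero,
      Finset.sum_ite_eq, Finset.sum_ite_eq', Finset.mem_univ, if_true] at h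
    rw [h1 x y hxy, mul_zero] at h
    exact (mul_eq_zero.1 h.symm).resolve_right (hd y)
  rw [mem_U_iff] at hu
  have hτ : τ⁻¹ * σ = 1 := by
    refine perm_eq_one_of_ord_le fun a => ?_
    by_contra hlt
    have := key ((τ⁻¹ * σ) a) a (not_le.1 hlt)
    rw [← Equiv.Perm.mul_apply, mul_inv_cancel_left, hu.2] at this
    exact one_ne_zero this
  have hτσ : τ = σ := inv_mul_eq_one.1 hτ
  -- With `τ = σ`, and `σ` reversing the order, `key` makes `u` lower triangular as well.
  have hu1 : u = 1 := by
    apply Subtype.ext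
    ext a b
    rcases lt_trichotomy (ord a) (ord b) with h | h | h
    · have h2 := key a.swap b.swap (by
        rw [ord_swap, ord_swap]
        have := ord_le b
        omega)
      rw [hτσ, hσ, hσ, Sum.swap_swap, Sum.swap_swap] at h2
      have : a ≠ b := fun h' => by rw [h'] at h; omega
      simp [h2, this]
    · rw [ord_injective h, hu.2]
      simp
    · rw [hu.1 _ _ h]
      have : a ≠ b := fun h' => by rw [h'] at h; omega
      simp [this]
  refine ⟨hu1, ?_⟩
  have hπ : π = ρ := by
    ext1 i
    have h2 := hw.idx_apply (Sum.inl i)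
    rw [← hτσ, hg.idx_apply] at h2
    exact h2.symm
  subst hτσ hπ
  have h2 : (∃ σ π, IsMono (g⁻¹ * w) σ π) := by
    let S : Subgroup (Sp n K) := finiteSubgroup {g | ∃ σ π, IsMono g σ π} ⟨1, 1, IsMono.one⟩
      (by rintro a b ⟨σ, π, h⟩ ⟨τ, ρ, h'⟩; exact ⟨_, _, h.mul h'⟩)
    exact S.mul_mem (S.inv_mem (x := g) ⟨_, _, hg⟩) (⟨_, _, hw⟩ : w ∈ S)
  obtain ⟨α, β, h2⟩ := h2
  have h3 := hg.mul h2
  rw [mul_inv_cancel_left] at h3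
  obtain ⟨h4, h5⟩ := h3.unique hw
  rw [mul_eq_left] at h4 h5
  rw [h4, h5] at h2
  exact mem_H_iff.2 h2

/-- The coefficient of a group element. -/
def coeffAt (g : Sp n K) : F[Sp n K] →ₗ[F] F where
  toFun x := x.coeff g
  map_add' _ _ := rfl
  map_smul' _ _ := rfl

lemma coeffAt_apply (g : Sp n K) (x : F[Sp n K]) : coeffAt g x = x.coeff g := rfl

lemma coeffAt_of_mul (g h : Sp n K) (x : F[Sp n K]) : coeffAt g (δ h * x) = coeffAt (h⁻¹ * g) x := by
  simp [coeffAt_apply, MonoidAlgebra.of_apply]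

lemma coeffAt_finsum {ι : Type*} [Finite ι] (g : Sp n K) (f : ι → F[Sp n K]) :
    coeffAt g (∑ᶠ i, f i) = ∑ᶠ i, coeffAt g (f i) :=
  (coeffAt (F := F) g).toAddMonoidHom.map_finsum (Set.toFinite _)

lemma coeffAt_sumB_of_mem {b : Sp n K} (hb : b ∈ B n K) : coeffAt b (sumB n K F) = 1 := by
  rw [sumB, coeffAt_finsum, finsum_eq_single _ (⟨b, hb⟩ : B n K)]
  · simp [coeffAt_apply, MonoidAlgebra.of_apply]
  · intro c hc
    have : c.1 ≠ b := fun h => hc (Subtype.ext h)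
    simp [coeffAt_apply, MonoidAlgebra.of_apply, this]

lemma coeffAt_sumB_of_notMem {b : Sp n K} (hb : b ∉ B n K) : coeffAt b (sumB n K F) = 0 := by
  rw [sumB, coeffAt_finsum]
  refine finsum_eq_zero_of_forall_eq_zero fun c => ?_
  have : c.1 ≠ b := fun h => hb (h ▸ c.2)
  simp [coeffAt_apply, MonoidAlgebra.of_apply, this]

/-- In the expansion of `e_χ` into the cosets `u n_c B`, the longest element `w₀` lies only in the
one with `u = 1` and `c = w₀ H`. Its coefficient is thus a sign times `χ(1)⁻¹`, nonzero in every
characteristic. -/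
lemma eChar_ne_zero (lam : AddChar K F) (x : V n K) : (eChar (chi lam x) : F[Sp n K]) ≠ 0 := by
  obtain ⟨w, hw, σ, π, hm, hσ⟩ := exists_longest n K
  have key : ∀ (u : U n K) (c : Weyl n K), (weylRep c)⁻¹ * (u.1⁻¹ * w) ∈ B n K →
      u = 1 ∧ c = QuotientGroup.mk ⟨w, hw⟩ := fun u c h => by
    obtain ⟨τ, ρ, hc⟩ := exists_isMono_weylRep c
    obtain ⟨h1, h2⟩ := eq_one_of_longest hm hσ hc (inv_mem u.2) h
    refine ⟨Subtype.ext (inv_eq_one.1 h1), ?_⟩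
    rw [← QuotientGroup.out_eq' c]
    exact QuotientGroup.eq.2 h2
  have hterm : ∀ (u : U n K) (c : Weyl n K),
      coeffAt w (δ u.1 * cosetTerm F (weylRep c)) =
        ((eps (weylRep c) : ℤ) : F) * coeffAt ((weylRep c)⁻¹ * (u.1⁻¹ * w)) (sumB n K F) :=
    fun u c => by
      rw [cosetTerm, mul_smul_comm, map_smul, smul_eq_mul, coeffAt_of_mul, coeffAt_of_mul]
  intro h0
  have h1 : coeffAt w (eChar (chi lam x)) =
      (chi lam x 1)⁻¹ * ((eps (weylRep (QuotientGroup.mk ⟨w, hw⟩ : Weyl n K)) : ℤ) : F) := by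
    rw [eChar, coeffAt_finsum, finsum_eq_single _ (1 : U n K)]
    · rw [map_smul, smul_eq_mul, Subgroup.coe_one, eSt_eq, mul_finsum_of_finite, coeffAt_finsum,
        finsum_eq_single _ (QuotientGroup.mk ⟨w, hw⟩ : Weyl n K)]
      · obtain ⟨h, hh, h2⟩ := exists_weylRep_mk (⟨w, hw⟩ : W2 n K)
        have h3 := hterm 1 (QuotientGroup.mk ⟨w, hw⟩)
        have h4 : (weylRep (QuotientGroup.mk ⟨w, hw⟩ : Weyl n K))⁻¹ * ((1 : U n K).1⁻¹ * w) =
            h⁻¹ := by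
          rw [h2]; simp
        rw [h4, coeffAt_sumB_of_mem (H_le_B (inv_mem hh)), mul_one] at h3
        rw [← h3, Subgroup.coe_one]
      · intro c hc
        have h3 := hterm 1 c
        rw [coeffAt_sumB_of_notMem fun h => hc (key 1 c h).2, mul_zero] at h3
        exact h3
    · intro u hu
      rw [map_smul, eSt_eq, mul_finsum_of_finite, coeffAt_finsum,
        finsum_eq_zero_of_forall_eq_zero, smul_zero]
      intro c
      rw [hterm, coeffAt_sumB_of_notMem fun h => hu (key u c h).1, mul_zero]
  rw [h0, map_zero] at h1
  refine mul_ne_zero (inv_ne_zero (chi_ne_zero lam x 1)) ?_ h1.symm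
  rcases Int.units_eq_one_or (eps (weylRep (QuotientGroup.mk ⟨w, hw⟩ : Weyl n K))) with h | h <;>
    simp [h]

end Eigenvector

/-! ### The stabilizer of `v_n` modulo `M` -/

section Embedding

variable [NeZero n]

/-- The block diagonal matrix with blocks `A` and `1`. -/
def embMat (A : Matrix {i : Fin n // i ≠ ⊤} {i : Fin n // i ≠ ⊤} K) : Matrix (Fin n) (Fin n) K :=
  (Matrix.fromBlocks A 0 0 (1 : Matrix {i : Fin n // ¬ i ≠ ⊤} {i : Fin n // ¬ i ≠ ⊤} K)).submatrix
    (Equiv.sumCompl fun i : Fin n => i ≠ ⊤).symm (Equiv.sumCompl fun i : Fin n => i ≠ ⊤).symm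

lemma embMat_apply (A : Matrix {i : Fin n // i ≠ ⊤} {i : Fin n // i ≠ ⊤} K) (i j : Fin n) :
    embMat A i j = if h : i ≠ ⊤ ∧ j ≠ ⊤ then A ⟨i, h.1⟩ ⟨j, h.2⟩ else if i = j then 1 else 0 := by
  rw [embMat, Matrix.submatrix_apply]
  by_cases hi : i ≠ ⊤ <;> by_cases hj : j ≠ ⊤
  · rw [Equiv.sumCompl_symm_apply_of_pos (p := fun i : Fin n => i ≠ ⊤) hi,
      Equiv.sumCompl_symm_apply_of_pos (p := fun i : Fin n => i ≠ ⊤) hj, dif_pos ⟨hi, hj⟩]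
    rfl
  · have hij : i ≠ j := fun h => hj (h ▸ hi)
    rw [Equiv.sumCompl_symm_apply_of_pos (p := fun i : Fin n => i ≠ ⊤) hi,
      Equiv.sumCompl_symm_apply_of_neg (p := fun i : Fin n => i ≠ ⊤) hj, dif_neg fun h => hj h.2,
      if_neg hij]
    rfl
  · have hij : i ≠ j := fun h => hi (h ▸ hj)
    rw [Equiv.sumCompl_symm_apply_of_neg (p := fun i : Fin n => i ≠ ⊤) hi,
      Equiv.sumCompl_symm_apply_of_pos (p := fun i : Fin n => i ≠ ⊤) hj, dif_neg fun h => hi h.1,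
      if_neg hij]
    rfl
  · have hij : i = j := (not_not.1 hi).trans (not_not.1 hj).symm
    subst hij
    rw [Equiv.sumCompl_symm_apply_of_neg (p := fun i : Fin n => i ≠ ⊤) hi, dif_neg fun h => hi h.1,
      if_pos rfl]
    exact Matrix.one_apply_eq _

lemma embMat_mul (A B : Matrix {i : Fin n // i ≠ ⊤} {i : Fin n // i ≠ ⊤} K) :
    embMat (A * B) = embMat A * embMat B := by
  rw [embMat, embMat, embMat, Matrix.submatrix_mul_equiv, Matrix.fromBlocks_multiply]
  simp

lemma det_embMat (A : Matrix {i : Fin n // i ≠ ⊤} {i : Fin n // i ≠ ⊤} K) :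
    (embMat A).det = A.det := by
  rw [embMat, Matrix.det_submatrix_equiv_self, Matrix.det_fromBlocks_zero₂₁, Matrix.det_one,
    mul_one]

end Embedding

/-! ### Elements of `Sp_M` that multiply `e_χ` by the cocycle -/

section Stabilizer

variable [Finite K]

lemma swap_mul_root_mul_swap_eq (i j : Fin n) (hij : i ≠ j) (t : K) :
    permSp K (Equiv.swap i j) * root j i hij.symm t * permSp K (Equiv.swap i j) =
      root i j hij t := by
  refine Sp_ext (fun k => ?_) fun k => ?_
  · rw [act_mul, act_mul, permSp_uVec, root_uVec, root_uVec]
    by_cases hi : k = i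
    · simp [hi, hij, hij.symm, permSp_uVec]
    · by_cases hj : k = j
      · simp [hj, act_add, act_smul, permSp_uVec]
      · simp [hi, hj, permSp_uVec, Equiv.swap_apply_of_ne_of_ne]
  · rw [act_mul, act_mul, permSp_vVec, root_vVec, root_vVec]
    by_cases hi : k = i
    · simp [hi, act_sub, act_smul, permSp_vVec]
    · by_cases hj : k = j
      · simp [hj, hij, hij.symm, permSp_vVec]
      · simp [hi, hj, permSp_vVec, Equiv.swap_apply_of_ne_of_ne]

variable [NeZero n] {F : Type v} [Field F]

local notation "δ" => MonoidAlgebra.of F (Sp n K)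

/-- The elements of `Sp_M` that fix `v_n` modulo `M` and act on `e_χ` by the cocycle. -/
def eigenStab (lam : AddChar K F) : Subgroup (Sp n K) :=
  finiteSubgroup {g | g ∈ SpM n K ∧ actN g (vLast n K) = vLast n K ∧
      δ g * eChar (chi lam (vVec ⊤)) = lam (coc g (vLast n K)) • eChar (chi lam (vVec ⊤))}
    ⟨one_mem _, actN_one _, by
      rw [map_one, one_mul, coc_eq_zero_of_act (act_one _), AddChar.map_zero_eq_one, one_smul]⟩
    (by
      rintro a b ⟨ha, ha1, ha2⟩ ⟨hb, hb1, hb2⟩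
      refine ⟨mul_mem ha hb, by rw [actN_mul ha, hb1, ha1], ?_⟩
      rw [map_mul, mul_assoc, hb2, mul_smul_comm, ha2, smul_smul, coc_mul ha, hb1,
        AddChar.map_add_eq_mul])

lemma mem_eigenStab_of_act {lam : AddChar K F} {g : Sp n K} (hg : g ∈ SpM n K)
    (h : act g (vVec ⊤) = vVec ⊤)
    (h' : δ g * eChar (chi lam (vVec ⊤)) = eChar (chi lam (vVec ⊤))) : g ∈ eigenStab lam := by
  have h1 : act g (ofN (vLast n K)) = ofN (vLast n K) := by rw [ofN_vLast, h]
  exact ⟨hg, by rw [actN, h1, projN_ofN],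
    by rw [h', coc_eq_zero_of_act h1, AddChar.map_zero_eq_one, one_smul]⟩

lemma U_le_eigenStab (lam : AddChar K F) : U n K ≤ eigenStab lam := fun g hg =>
  ⟨U_le_SpM hg, actN_vLast_of_mem_U hg, by
    rw [of_mul_eChar_of_mem_U lam hg, chi_eq_of_actN (actN_vLast_of_mem_U hg)]⟩

lemma permSp_mem_SpM (σ : Equiv.Perm (Fin n)) : permSp K σ ∈ SpM n K :=
  mem_SpM_iff.2 fun _ _ => rfl

lemma swap_mem_eigenStab (lam : AddChar K F) (hq : ((Nat.card K : ℕ) : F) + 1 = 0) {i j : Fin n}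
    (hi : i ≠ ⊤) (hj : j ≠ ⊤) : permSp K (Equiv.swap i j) ∈ eigenStab lam := by
  refine permSp_swap_mem (m := max i j) (fun i' j' h hj' => ?_) i j (le_max_left _ _)
    (le_max_right _ _)
  have hj'' : j' < ⊤ := hj'.trans_lt (max_lt (lt_top_iff_ne_top.2 hi) (lt_top_iff_ne_top.2 hj))
  have hi'' : i' < ⊤ := lt_trans (by rw [Fin.lt_def]; omega) hj''
  refine mem_eigenStab_of_act (permSp_mem_SpM _) ?_ (swap_mul_eChar lam hq h hj''.ne)
  rw [permSp_vVec, Equiv.swap_apply_of_ne_of_ne hi''.ne' hj''.ne']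

lemma root_mem_eigenStab (lam : AddChar K F) (hq : ((Nat.card K : ℕ) : F) + 1 = 0) {i j : Fin n}
    (hij : i ≠ j) (hi : i ≠ ⊤) (hj : j ≠ ⊤) (t : K) : root i j hij t ∈ eigenStab lam := by
  rcases lt_or_gt_of_ne hij with h | h
  · exact U_le_eigenStab lam (root_mem_U h t)
  · rw [← swap_mul_root_mul_swap_eq]
    exact mul_mem (mul_mem (swap_mem_eigenStab lam hq hi hj)
      (U_le_eigenStab lam (root_mem_U h t))) (swap_mem_eigenStab lam hq hi hj)

/-- `GL_{n-1}` is generated by diagonal matrices and transvections: the former lie in `H` and fix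
`v_n`, the latter are root elements with both indices below `n`. -/
lemma levi_mem_eigenStab_of_embMat (lam : AddChar K F) (hq : ((Nat.card K : ℕ) : F) + 1 = 0)
    (A' : Matrix {i : Fin n // i ≠ ⊤} {i : Fin n // i ≠ ⊤} K) (hA' : A'.det ≠ 0) :
    ∀ A : GL (Fin n) K, A.1 = embMat A' → levi n K A ∈ eigenStab lam := by
  refine Matrix.diagonal_transvection_induction_of_det_ne_zero
    (fun A' => ∀ A : GL (Fin n) K, A.1 = embMat A' → levi n K A ∈ eigenStab lam) A' hA'
    (fun D hD A hA => ?_) (fun t A hA => ?_) fun A₁ A₂ h1 h2 ih1 ih2 A hA => ?_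
  · have hD' : ∀ i, D i ≠ 0 := fun i h => hD (by
      rw [Matrix.det_diagonal]; exact Finset.prod_eq_zero (Finset.mem_univ i) h)
    let d : Fin n → Kˣ := fun i => if h : i ≠ ⊤ then Units.mk0 (D ⟨i, h⟩) (hD' _) else 1
    have h : levi n K A = diagSp d := by
      rw [diagSp]
      congr 1
      apply Units.ext
      rw [hA]
      ext i j
      change _ = Matrix.diagonal (fun i => (d i : K)) i j
      rw [embMat_apply, Matrix.diagonal_apply]
      by_cases hij : i = j
      · subst hij
        by_cases hi : i = ⊤ <;> simp [hi, d]
      · simp [hij]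
    have hact : act (diagSp d) (vVec ⊤) = vVec ⊤ := by rw [diagSp_vVec]; simp [d]
    rw [h]
    refine mem_eigenStab_of_act (H_le_SpM (diagSp_mem_H d)) hact ?_
    rw [of_mul_eChar_of_mem_H lam _ (diagSp_mem_H d), hact]
  · obtain ⟨i, j, hij, c⟩ := t
    have hij' : i.1 ≠ j.1 := fun h => hij (Subtype.ext h)
    have h : levi n K A = root i.1 j.1 hij' c := by
      rw [root]
      congr 1
      apply Units.ext
      rw [hA]
      ext a b
      rw [embMat_apply]
      change _ = Matrix.transvection i.1 j.1 c a b
      simp only [Matrix.TransvectionStruct.toMatrix, Matrix.transvection, Matrix.add_apply,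
        Matrix.one_apply, Matrix.single_apply, Subtype.ext_iff]
      split_ifs with h1 <;> simp_all
      · rename_i h4
        exact absurd (h4.2.trans (h1 (h4.1 ▸ i.2))) j.2
    rw [h]
    exact root_mem_eigenStab lam hq hij' i.2 j.2 c
  · have hd1 : (embMat A₁).det ≠ 0 := by rwa [det_embMat]
    have hd2 : (embMat A₂).det ≠ 0 := by rwa [det_embMat]
    let E₁ := Matrix.GeneralLinearGroup.mkOfDetNeZero (embMat A₁) hd1
    let E₂ := Matrix.GeneralLinearGroup.mkOfDetNeZero (embMat A₂) hd2
    have h : A = E₁ * E₂ := Units.ext (by rw [hA, embMat_mul]; rfl)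
    rw [h, map_mul]
    exact mul_mem (ih1 E₁ rfl) (ih2 E₂ rfl)

lemma levi_mem_eigenStab (lam : AddChar K F) (hq : ((Nat.card K : ℕ) : F) + 1 = 0)
    (A : GL (Fin n) K) (hA : ∀ j, A.1 ⊤ j = if ⊤ = j then 1 else 0) :
    levi n K A ∈ eigenStab lam := by
  -- `C` is the identity with its last column replaced by that of `A`. As the last row of `A` is
  -- that of the identity, `C` is upper unitriangular and `A = C diag(A', 1)`.
  let C : Matrix (Fin n) (Fin n) K := Matrix.of fun i j =>
    if j = ⊤ then A.1 i ⊤ else if i = j then 1 else 0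
  let A' : Matrix {i : Fin n // i ≠ ⊤} {i : Fin n // i ≠ ⊤} K := A.1.submatrix (↑) (↑)
  have hC : A.1 = C * embMat A' := by
    ext i j
    rw [Matrix.mul_apply]
    by_cases hj : j = ⊤
    · subst hj
      rw [Finset.sum_eq_single ⊤]
      · simp [embMat_apply, C]
      · intro k _ hk
        simp [embMat_apply, hk]
      · simp
    · by_cases hi : i = ⊤
      · subst hi
        rw [hA, if_neg (Ne.symm hj)]
        refine (Finset.sum_eq_zero fun k _ => ?_).symm
        by_cases hk : k = ⊤
        · simp [hk, embMat_apply, Ne.symm hj]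
        · simp [C, hk, Ne.symm hk]
      · rw [Finset.sum_eq_single i]
        · simp [embMat_apply, C, hi, hj, A']
        · intro k _ hk
          by_cases hk' : k = ⊤
          · simp [hk', embMat_apply, Ne.symm hj]
          · simp [C, hk', Ne.symm hk]
        · simp
  have hdet : (embMat A').det ≠ 0 := fun h => by
    have h1 : A.1.det = 0 := by rw [hC, Matrix.det_mul, h, mul_zero]
    have h2 := (Matrix.isUnit_iff_isUnit_det A.1).1 A.isUnit
    rw [h1] at h2
    exact not_isUnit_zero h2
  let E := Matrix.GeneralLinearGroup.mkOfDetNeZero (embMat A') hdet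
  have hE : levi n K E ∈ eigenStab lam :=
    levi_mem_eigenStab_of_embMat lam hq A' (by rwa [← det_embMat]) E rfl
  have hAE : (A * E⁻¹).1 = C := by
    rw [Units.val_mul, hC, mul_assoc]
    have : embMat A' * (E⁻¹).1 = 1 := E.mul_inv
    rw [this, mul_one]
  have hU : levi n K (A * E⁻¹) ∈ U n K := by
    rw [U_eq_upperUni]
    refine ⟨fun _ _ => rfl, fun i j hij => ?_, fun i => ?_⟩
    · change (A * E⁻¹).1 i j = 0
      have : j ≠ ⊤ := fun h => absurd (le_top : i ≤ ⊤) (h ▸ hij.not_ge)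
      simp [hAE, C, this, hij.ne']
    · change (A * E⁻¹).1 i i = 1
      by_cases hi : i = ⊤
      · simp [hAE, C, hi, hA]
      · simp [hAE, C, hi]
  have h := mul_mem (U_le_eigenStab lam hU) hE
  rwa [← map_mul, inv_mul_cancel_right] at h

/-- Modulo `Sp^M ⊆ U` only the block `A` matters. It acts on `V / M` by `ᵗA⁻¹`, so fixing `v_n`
there means that the last row of `A⁻¹`, hence of `A`, is that of the identity. -/
theorem mem_eigenStab (lam : AddChar K F) (hq : ((Nat.card K : ℕ) : F) + 1 = 0) {g : Sp n K}
    (hg : g ∈ SpM n K) (h : actN g (vLast n K) = vLast n K) : g ∈ eigenStab lam := by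
  obtain ⟨A, -, hD, hs⟩ := exists_levi_mul hg
  have h1 : ∀ k, (A⁻¹ : GL (Fin n) K).1 ⊤ k = if k = ⊤ then 1 else 0 := fun k => by
    have h2 : (A⁻¹ : GL (Fin n) K).1 ⊤ k = g.1 (Sum.inr k) (Sum.inr ⊤) :=
      congrFun (congrFun hD k) ⊤
    rw [h2, ← actN_vLast, h, vLast, Pi.single_apply]
  have hA : levi n K A ∈ eigenStab lam := by
    refine levi_mem_eigenStab lam hq A fun j => ?_
    have h2 : ((A⁻¹ : GL (Fin n) K).1 * A.1) ⊤ j = (1 : Matrix (Fin n) (Fin n) K) ⊤ j := by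
      rw [← Units.val_mul, inv_mul_cancel, Units.val_one]
    rw [Matrix.mul_apply, Matrix.one_apply] at h2
    simpa [h1] using h2
  have := mul_mem hA (U_le_eigenStab lam ((le_sup_right : SpPt n K ≤ U n K) hs))
  rwa [mul_inv_cancel_left] at this

/-- If `q = -1` in `F`, then the elements of `Sp_M` that fix `v_n` modulo `M` up to sign act on
`e_χ` by the cocycle. -/
theorem of_mul_eChar (lam : AddChar K F) (hq : ((Nat.card K : ℕ) : F) + 1 = 0) {g : Sp n K}
    (hg : g ∈ SpM n K) (h : actN g (vLast n K) = vLast n K ∨ actN g (vLast n K) = -vLast n K) :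
    δ g * eChar (chi lam (vVec ⊤)) = lam (coc g (vLast n K)) • eChar (chi lam (vVec ⊤)) := by
  rcases h with h | h
  · exact (mem_eigenStab lam hq hg h).2.2
  · let z : Sp n K := diagSp fun _ => -1
    have hz : z ∈ H n K := diagSp_mem_H _
    have h1 : act z (vVec ⊤) = -vVec ⊤ := by
      rw [diagSp_vVec]; simp
    have h1' : act z (ofN (vLast n K)) = ofN (-vLast n K) := by rw [ofN_neg, ofN_vLast, h1]
    have h2 : actN z (vLast n K) = -vLast n K := by rw [actN, h1', projN_ofN]
    have h3 : δ z * eChar (chi lam (vVec ⊤)) = eChar (chi lam (vVec ⊤)) := by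
      rw [of_mul_eChar_of_mem_H lam _ hz, h1]
      congr 1
      ext g
      rw [chi, chi, act_neg, form_neg_neg]
    have h4 := (mem_eigenStab lam hq (mul_mem hg (H_le_SpM hz))
      (by rw [actN_mul hg, h2, actN_neg, h, neg_neg])).2.2
    rwa [map_mul, mul_assoc, h3, coc_mul hg, h2, coc_neg, coc_eq_zero_of_act h1', zero_add] at h4

end Stabilizer

/-! ### The module `L` -/

lemma addChar_ne_zero {F : Type v} [Field F] (lam : AddChar K F) (a : K) : lam a ≠ 0 := by
  intro h
  have := lam.map_add_eq_mul a (-a)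
  rw [add_neg_cancel, AddChar.map_zero_eq_one, h, zero_mul] at this
  exact one_ne_zero this

section Sign

variable {x : Fin n → K}

/-- A choice of one vector in each pair `{x, -x}` of nonzero vectors. -/
def IsPositive (x : Fin n → K) : Prop := x ≠ 0 ∧ (WellOrderingRel x (-x) ∨ x = -x)

lemma isPositive_or_neg (hx : x ≠ 0) : IsPositive x ∨ IsPositive (-x) := by
  rcases trichotomous_of WellOrderingRel x (-x) with h | h | h
  · exact Or.inl ⟨hx, Or.inl h⟩
  · exact Or.inl ⟨hx, Or.inr h⟩
  · exact Or.inr ⟨neg_ne_zero.2 hx, Or.inl (by rwa [neg_neg])⟩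

lemma IsPositive.eq_neg (h : IsPositive x) (h' : IsPositive (-x)) : x = -x := by
  rcases h.2 with h1 | h1
  · rcases h'.2 with h2 | h2
    · rw [neg_neg] at h2
      exact absurd h2 (asymm_of WellOrderingRel h1)
    · rw [neg_neg] at h2
      exact h2.symm
  · exact h1

lemma neg_eq_self_iff_of_ne_zero (hx : x ≠ 0) : x = -x ↔ ringChar K = 2 := by
  constructor
  · intro h
    by_contra h2
    obtain ⟨i, hi⟩ := Function.ne_iff.1 hx
    have h3 : x i + x i = 0 := by
      nth_rewrite 2 [h]
      simp
    rw [← two_mul] at h3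
    exact (mul_ne_zero (Ring.two_ne_zero h2) hi) h3
  · intro h
    have : CharP K 2 := ringChar.of_eq h
    ext i
    exact (CharTwo.neg_eq (x i)).symm

end Sign

section Translates

variable [Finite K] [NeZero n] {F : Type v} [Field F]

local notation "δ" => MonoidAlgebra.of F (Sp n K)

/-- The translate of `e_χ` by `g`, normalized so that it depends only on `g v_n` modulo `M`. -/
def translate (lam : AddChar K F) (g : Sp n K) : F[Sp n K] :=
  (lam (coc g (vLast n K)))⁻¹ • (δ g * eChar (chi lam (vVec ⊤)))

lemma of_mul_translate (lam : AddChar K F) {h g : Sp n K} (hh : h ∈ SpM n K) :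
    δ h * translate lam g = lam (coc h (actN g (vLast n K))) • translate lam (h * g) := by
  have h1 := addChar_ne_zero lam (coc h (actN g (vLast n K)))
  rw [translate, translate, coc_mul hh, AddChar.map_add_eq_mul, smul_smul, _root_.mul_inv_rev,
    mul_inv_cancel_left₀ h1, map_mul, mul_smul_comm, mul_assoc]

/-- `h⁻¹ g` fixes `v_n` up to sign modulo `M`, so it acts on `e_χ` by the cocycle, which is exactly
what the normalization divides out. -/
lemma translate_eq (lam : AddChar K F) (hq : ((Nat.card K : ℕ) : F) + 1 = 0) {g h : Sp n K}
    (hg : g ∈ SpM n K) (hh : h ∈ SpM n K)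
    (hgh : actN g (vLast n K) = actN h (vLast n K) ∨
      actN g (vLast n K) = -actN h (vLast n K)) :
    translate lam g = translate lam h := by
  have hk : h⁻¹ * g ∈ SpM n K := mul_mem (inv_mem hh) hg
  have h1 : actN (h⁻¹ * g) (vLast n K) = vLast n K ∨
      actN (h⁻¹ * g) (vLast n K) = -vLast n K := by
    have h2 : actN h⁻¹ (actN h (vLast n K)) = vLast n K := by
      rw [← actN_mul (inv_mem hh), inv_mul_cancel, actN_one]
    rw [actN_mul (inv_mem hh)]
    rcases hgh with e | e
    · exact Or.inl (by rw [e, h2])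
    · exact Or.inr (by rw [e, actN_neg, h2])
  have h3 : coc h (actN (h⁻¹ * g) (vLast n K)) = coc h (vLast n K) := by
    rcases h1 with e | e
    · rw [e]
    · rw [e, coc_neg]
  have h4 : translate lam (h⁻¹ * g) = eChar (chi lam (vVec ⊤)) := by
    rw [translate, of_mul_eChar lam hq hk h1, smul_smul, inv_mul_cancel₀ (addChar_ne_zero _ _),
      one_smul]
  have h5 := of_mul_translate lam (g := h⁻¹ * g) hh
  rw [h4, h3, mul_inv_cancel_left] at h5
  rw [translate.eq_1 lam h, h5, smul_smul, inv_mul_cancel₀ (addChar_ne_zero _ _), one_smul]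

lemma translate_ne_zero (lam : AddChar K F) (g : Sp n K) : translate lam g ≠ 0 := by
  refine smul_ne_zero (inv_ne_zero (addChar_ne_zero _ _)) fun h => eChar_ne_zero (n := n) lam (vVec ⊤) ?_
  rw [← one_mul (eChar _), ← map_one (MonoidAlgebra.of F (Sp n K)), ← inv_mul_cancel g, map_mul,
    mul_assoc, h, mul_zero]

/-- The element of `H` that multiplies all `v_i` by `α`. -/
def scaleSp (α : Kˣ) : Sp n K := diagSp fun _ => α⁻¹

lemma scaleSp_mem_H (α : Kˣ) : (scaleSp α : Sp n K) ∈ H n K := diagSp_mem_H _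

lemma scaleSp_vVec (α : Kˣ) (i : Fin n) : act (scaleSp α) (vVec i) = (α : K) • vVec i := by
  rw [scaleSp, diagSp_vVec, inv_inv]

lemma wCyc_mem_SpM (i : Fin n) : wCyc K i ∈ SpM n K := permSp_mem_SpM _

lemma act_wCyc_mul_scaleSp (i : Fin n) (α : Kˣ) :
    act (wCyc K i * scaleSp α) (ofN (vLast n K)) = ofN (Pi.single i (α : K)) := by
  rw [ofN_vLast, act_mul, scaleSp_vVec, act_smul, wCyc, permSp_vVec, ofN_single,
    Fin.cycleIcc_of_last le_top]

lemma wCyc_mul_scaleSp_mem_SpM (i : Fin n) (α : Kˣ) : wCyc K i * scaleSp α ∈ SpM n K :=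
  mul_mem (wCyc_mem_SpM i) (H_le_SpM (scaleSp_mem_H α))

/-- An element of `H` carries `e_χ` to the vector for `α v_n`, so all `α` reduce to `α = 1`. The
normalizing scalar is `1` because the element maps `v_n` into `N`, to `α v_i`. -/
lemma of_wCyc_mul_eChar (lam : AddChar K F) (i : Fin n) (α : Kˣ) :
    δ (wCyc K i) * eChar (chi lam ((α : K) • vVec ⊤)) = translate lam (wCyc K i * scaleSp α) := by
  rw [translate, coc_eq_zero_of_act (act_wCyc_mul_scaleSp i α), AddChar.map_zero_eq_one, inv_one,
    one_smul, map_mul, mul_assoc, of_mul_eChar_of_mem_H lam _ (scaleSp_mem_H α), scaleSp_vVec]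

/-- The generators of `I_{α,i}` are the translates of `e_χ` up to scalars. -/
lemma of_mul_of_wCyc_mul_eChar (lam : AddChar K F) (i : Fin n) (α : Kˣ) {u : Sp n K}
    (hu : u ∈ U n K) :
    δ u * (δ (wCyc K i) * eChar (chi lam ((α : K) • vVec ⊤))) =
      lam (coc u (actN (wCyc K i * scaleSp α) (vLast n K))) •
        translate lam (u * (wCyc K i * scaleSp α)) := by
  rw [of_wCyc_mul_eChar, of_mul_translate lam (U_le_SpM hu)]

/-- `U` acts transitively on the vectors of `N` with given leading coordinate. -/
lemma exists_mem_U_actN {x : Fin n → K} {i : Fin n} {α : Kˣ} (hx : ∀ j < i, x j = 0)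
    (hi : x i = α) : ∃ u ∈ U n K, actN (u * (wCyc K i * scaleSp α)) (vLast n K) = x := by
  -- The action on `N` is to be `1 + Y`, with `α` times its `i`-th column equal to `x`. As `Y² = 0`,
  -- its inverse is `1 - Y`, which gives `A = ᵗ(1 - Y)`.
  let Y : Matrix (Fin n) (Fin n) K := Matrix.of fun a b =>
    if b = i ∧ a ≠ i then x a * (α⁻¹ : Kˣ) else 0
  have hY : Y * Y = 0 := by
    ext a b
    rw [Matrix.mul_apply]
    refine Finset.sum_eq_zero fun k _ => ?_
    by_cases hk : k = i <;> simp [Y, hk]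
  let A : GL (Fin n) K := ⟨(1 - Y)ᵀ, (1 + Y)ᵀ,
    by rw [← Matrix.transpose_mul, show (1 + Y) * (1 - Y) = 1 - Y * Y by noncomm_ring, hY, sub_zero,
      Matrix.transpose_one],
    by rw [← Matrix.transpose_mul, show (1 - Y) * (1 + Y) = 1 - Y * Y by noncomm_ring, hY, sub_zero,
      Matrix.transpose_one]⟩
  have hYlow : ∀ a b : Fin n, a ≤ b → Y a b = 0 := fun a b hab => by
    by_cases h : b = i ∧ a ≠ i
    · have : a < i := lt_of_le_of_ne (h.1 ▸ hab) h.2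
      simp [Y, hx a this]
    · simp only [Y, Matrix.of_apply, if_neg h]
  have hU : levi n K A ∈ U n K := by
    rw [U_eq_upperUni]
    refine ⟨fun _ _ => rfl, fun a b hab => ?_, fun a => ?_⟩
    · change (1 - Y) b a = 0
      rw [Matrix.sub_apply, hYlow b a hab.le, Matrix.one_apply_ne hab.ne, sub_zero]
    · change (1 - Y) a a = 1
      rw [Matrix.sub_apply, hYlow a a le_rfl, Matrix.one_apply_eq, sub_zero]
  refine ⟨levi n K A, hU, ?_⟩
  rw [actN_mul (U_le_SpM hU), actN.eq_1 (wCyc K i * _), act_wCyc_mul_scaleSp, projN_ofN]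
  ext j
  rw [actN_single]
  change (α : K) * (1 + Y) j i = x j
  rw [Matrix.add_apply]
  by_cases hj : j = i
  · subst hj
    simp [Y, hi]
  · rw [Matrix.one_apply_ne hj, zero_add]
    simp only [Y, Matrix.of_apply, hj, ne_eq, not_false_eq_true, and_self, if_true]
    rw [mul_comm, mul_assoc, ← Units.val_mul, inv_mul_cancel, Units.val_one, mul_one]

lemma exists_leading {x : Fin n → K} (hx : x ≠ 0) :
    ∃ (i : Fin n) (α : Kˣ), (∀ j < i, x j = 0) ∧ x i = α := by
  classical
  obtain ⟨k, hk⟩ := Function.ne_iff.1 hx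
  let s : Finset (Fin n) := Finset.univ.filter fun i => x i ≠ 0
  have hs : s.Nonempty := ⟨k, by simpa [s] using hk⟩
  refine ⟨s.min' hs, Units.mk0 (x (s.min' hs)) (by simpa [s] using s.min'_mem hs),
    fun j hj => ?_, rfl⟩
  by_contra h
  exact absurd (s.min'_le j (by simpa [s] using h)) hj.not_ge

lemma exists_actN_eq {x : Fin n → K} (hx : x ≠ 0) :
    ∃ g ∈ SpM n K, actN g (vLast n K) = x := by
  obtain ⟨i, α, h1, h2⟩ := exists_leading hx
  obtain ⟨u, hu, h⟩ := exists_mem_U_actN h1 h2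
  exact ⟨_, mul_mem (U_le_SpM hu) (wCyc_mul_scaleSp_mem_SpM i α), h⟩

lemma vLast_ne_zero : vLast n K ≠ 0 := by
  intro h
  have := congrFun h ⊤
  simp [vLast] at this

/-- `L` is spanned by the translates of `e_χ`. -/
theorem LMod_eq_span (lam : AddChar K F) (hq : ((Nat.card K : ℕ) : F) + 1 = 0) {Tq : Set Kˣ}
    (hTq : IsTransversal Tq) :
    LMod n lam Tq = Submodule.span F {y | ∃ g ∈ SpM n K, y = translate lam g} := by
  apply le_antisymm
  · refine iSup_le fun i => iSup₂_le fun α _ => Submodule.span_le.2 ?_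
    rintro _ ⟨u, rfl⟩
    dsimp only
    rw [of_mul_of_wCyc_mul_eChar lam i α u.2]
    exact Submodule.smul_mem _ _ (Submodule.subset_span
      ⟨_, mul_mem (U_le_SpM u.2) (wCyc_mul_scaleSp_mem_SpM i α), rfl⟩)
  · rw [Submodule.span_le]
    rintro _ ⟨g, hg, rfl⟩
    have hx : actN g (vLast n K) ≠ 0 := actN_ne_zero ⟨g, hg⟩ vLast_ne_zero
    obtain ⟨i, α, h1, h2⟩ := exists_leading hx
    -- Translates do not see the sign of the vector, so the leading coordinate may be changed to the
    -- representative `β = ±α` in the transversal.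
    obtain ⟨β, ⟨hβ, hβα⟩, -⟩ := hTq α
    obtain ⟨u, hu, h⟩ : ∃ u ∈ U n K,
        actN (u * (wCyc K i * scaleSp β)) (vLast n K) = actN g (vLast n K) ∨
        actN (u * (wCyc K i * scaleSp β)) (vLast n K) = -actN g (vLast n K) := by
      rcases hβα with rfl | rfl
      · obtain ⟨u, hu, h⟩ := exists_mem_U_actN h1 h2
        exact ⟨u, hu, Or.inl h⟩
      · obtain ⟨u, hu, h⟩ := exists_mem_U_actN (x := -actN g (vLast n K)) (i := i) (α := -α)
          (fun j hj => by simp [h1 j hj]) (by simp [h2])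
        exact ⟨u, hu, Or.inr h⟩
    have h3 := of_mul_of_wCyc_mul_eChar lam i β hu
    have h4 : MonoidAlgebra.of F (Sp n K) u *
        (MonoidAlgebra.of F (Sp n K) (wCyc K i) * eChar (chi lam ((β : K) • vVec ⊤))) ∈
          LMod n lam Tq :=
      le_iSup (fun i => IMod lam Tq i) i (le_iSup₂ (f := fun (α : Kˣ) (_ : α ∈ Tq) =>
        IMod₂ lam (α : K) i) β hβ (Submodule.subset_span ⟨⟨u, hu⟩, rfl⟩))
    rw [h3, Submodule.smul_mem_iff _ (addChar_ne_zero _ _)] at h4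
    rwa [← translate_eq lam hq (mul_mem (U_le_SpM hu) (wCyc_mul_scaleSp_mem_SpM i β)) hg h]

lemma LMod_le_steinberg (lam : AddChar K F) (Tq : Set Kˣ) :
    LMod n lam Tq ≤ steinberg n K F := by
  refine iSup_le fun i => iSup₂_le fun α _ => Submodule.span_le.2 ?_
  rintro _ ⟨u, rfl⟩
  refine Ideal.mul_mem_left _ _ (Ideal.mul_mem_left _ _ ?_)
  have := Fintype.ofFinite (U n K)
  rw [eChar, finsum_eq_sum_of_fintype]
  exact (steinberg n K F).sum_mem fun u _ => (steinberg n K F).smul_mem _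
    (Ideal.mul_mem_left _ _ (Ideal.subset_span rfl))

variable (lam : AddChar K F) {x : Fin n → K}

/-- The translate of `e_χ` that belongs to a vector of `N`. -/
def vecTranslate (x : Fin n → K) : F[Sp n K] :=
  open Classical in if h : x ≠ 0 then translate lam (exists_actN_eq h).choose else 0

lemma vecTranslate_eq (hq : ((Nat.card K : ℕ) : F) + 1 = 0) {g : Sp n K} (hg : g ∈ SpM n K)
    (h : actN g (vLast n K) = x ∨ actN g (vLast n K) = -x) :
    vecTranslate lam x = translate lam g := by
  have hx : x ≠ 0 := by
    rintro rfl
    rw [neg_zero, or_self] at h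
    exact actN_ne_zero ⟨g, hg⟩ vLast_ne_zero h
  obtain ⟨h1, h2⟩ := (exists_actN_eq hx).choose_spec
  rw [vecTranslate, dif_pos hx]
  refine (translate_eq lam hq hg h1 ?_).symm
  rwa [h2]

lemma of_mul_vecTranslate (hq : ((Nat.card K : ℕ) : F) + 1 = 0) (g : SpM n K) (hx : x ≠ 0) :
    δ g.1 * vecTranslate lam x = lam (coc g.1 x) • vecTranslate lam (actN g.1 x) := by
  obtain ⟨h, hh, rfl⟩ := exists_actN_eq hx
  rw [vecTranslate_eq lam hq hh (Or.inl rfl), of_mul_translate lam g.2,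
    vecTranslate_eq lam hq (mul_mem g.2 hh) (Or.inl (actN_mul g.2 h _))]

/-- The linear map with `E⁺_x ↦ vecTranslate x`. -/
def weilMap : ((Fin n → K) →₀ F) →ₗ[F] F[Sp n K] :=
  open Classical in
  -- The map is defined on all of `X`, and the value `0` at the other member of a pair makes `E_x +
  -- E_{-x}` go to a single translate, not to twice it. This also works when `F` has characteristic
  -- `2`; equivariance is claimed on `X⁺` only.
  Finsupp.linearCombination F fun x => if IsPositive x then vecTranslate lam x else 0

lemma vecTranslate_neg (hq : ((Nat.card K : ℕ) : F) + 1 = 0) (hx : x ≠ 0) :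
    vecTranslate lam (-x) = vecTranslate lam x := by
  obtain ⟨g, hg, h⟩ := exists_actN_eq hx
  rw [vecTranslate_eq lam hq hg (Or.inl h), vecTranslate_eq lam hq hg (Or.inr (by rw [h, neg_neg]))]

lemma weilMap_EPlus (hq : ((Nat.card K : ℕ) : F) + 1 = 0) (hx : x ≠ 0) :
    weilMap lam (EPlus K F x) = vecTranslate lam x := by
  unfold EPlus weilMap
  split_ifs with h
  · have h1 : IsPositive x := ⟨hx, Or.inr ((neg_eq_self_iff_of_ne_zero hx).2 h)⟩
    rw [Finsupp.linearCombination_single, one_smul, if_pos h1]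
  · rw [map_add, Finsupp.linearCombination_single, Finsupp.linearCombination_single, one_smul,
      one_smul]
    rcases isPositive_or_neg hx with h1 | h1
    · rw [if_pos h1, if_neg fun h2 => h ((neg_eq_self_iff_of_ne_zero hx).1 (h1.eq_neg h2)),
        add_zero]
    · rw [if_pos h1, if_neg fun h2 => h ((neg_eq_self_iff_of_ne_zero hx).1 (h2.eq_neg h1)),
        zero_add, vecTranslate_neg lam hq hx]

end Translates

/-! ### Irreducibility of `X⁺` -/

section Symmetric

/-- The element `1 + S` of `Sp^M`, for a symmetric matrix `S`. -/
def symSp (S : Matrix (Fin n) (Fin n) K) (hS : Sᵀ = S) : Sp n K :=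
  ⟨Matrix.fromBlocks 1 S 0 1, by
    rw [SymplecticGroup.fromBlocks_mem_iff]
    simp [hS]⟩

lemma symSp_mem_SpPt [Finite K] (S : Matrix (Fin n) (Fin n) K) (hS : Sᵀ = S) :
    symSp S hS ∈ SpPt n K := by
  refine mem_SpPt_of_uVec fun i => ?_
  ext (j | j) <;> rw [act_uVec] <;>
    simp [symSp, uVec, Matrix.one_apply, Pi.single_apply]

lemma act_symSp (S : Matrix (Fin n) (Fin n) K) (hS : Sᵀ = S) (x : Fin n → K) :
    act (symSp S hS) (ofN x) = Sum.elim (S *ᵥ x) x := by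
  rw [act, symSp, ofN, Matrix.fromBlocks_mulVec]
  simp

lemma actN_symSp (S : Matrix (Fin n) (Fin n) K) (hS : Sᵀ = S) (x : Fin n → K) :
    actN (symSp S hS) x = x := by
  rw [actN, act_symSp]; rfl

lemma coc_symSp (S : Matrix (Fin n) (Fin n) K) (hS : Sᵀ = S) (x : Fin n → K) :
    coc (symSp S hS) x = (S *ᵥ x) ⬝ᵥ x := by
  rw [coc, actN_symSp, act_symSp]
  simp [form, ofN, dotProduct]

lemma single_mulVec_dotProduct (i j : Fin n) (c : K) (x : Fin n → K) :
    (Matrix.single i j c *ᵥ x) ⬝ᵥ x = c * (x j * x i) := by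
  rw [Matrix.single_mulVec, dotProduct, Finset.sum_eq_single i]
  · simp [mul_assoc]
  · intro k _ hk
    simp [hk]
  · simp

/-- Vectors with the same quadratic evaluations agree up to sign. -/
lemma eq_or_eq_neg_of_forall_symmetric {x y : Fin n → K}
    (h : ∀ S : Matrix (Fin n) (Fin n) K, Sᵀ = S → (S *ᵥ x) ⬝ᵥ x = (S *ᵥ y) ⬝ᵥ y) :
    x = y ∨ x = -y := by
  -- Diagonal `S` determines each coordinate up to sign. This is enough in characteristic `2`;
  -- otherwise the off-diagonal `S` below make the signs agree.
  have hsq : ∀ i, x i = y i ∨ x i = -y i := fun i => by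
    have := h (Matrix.single i i 1) (by simp)
    rwa [single_mulVec_dotProduct, single_mulVec_dotProduct, one_mul, one_mul,
      mul_self_eq_mul_self_iff] at this
  have hprod : ∀ i j, 2 * (x i * x j) = 2 * (y i * y j) := fun i j => by
    have := h (Matrix.single i j 1 + Matrix.single j i 1) (by simp [add_comm])
    simp only [Matrix.add_mulVec, add_dotProduct, single_mulVec_dotProduct] at this
    linear_combination this
  by_cases h2 : (2 : K) = 0
  · left
    ext i
    rcases hsq i with h3 | h3
    · exact h3
    · rw [h3, neg_eq_iff_add_eq_zero, ← two_mul, h2, zero_mul]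
  by_cases hx : x = 0
  · left
    ext i
    have h3 := hsq i
    rw [hx, Pi.zero_apply] at h3 ⊢
    rcases h3 with h3 | h3
    · exact h3
    · exact (neg_eq_zero.1 h3.symm).symm
  obtain ⟨i, hi⟩ := Function.ne_iff.1 hx
  have hprod' : ∀ j, x i * x j = y i * y j := fun j => mul_left_cancel₀ h2 (hprod i j)
  rcases hsq i with h3 | h3
  · left
    ext j
    exact mul_left_cancel₀ hi (by rw [hprod', h3])
  · right
    ext j
    exact mul_left_cancel₀ hi (by rw [hprod', Pi.neg_apply, h3, neg_mul_neg])

lemma exists_separating [Finite K] {F : Type v} [Field F] {lam : AddChar K F} (hlam : lam ≠ 1)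
    {x y : Fin n → K} (h1 : x ≠ y) (h2 : x ≠ -y) :
    ∃ s ∈ SpPt n K, (∀ z, actN s z = z) ∧ lam (coc s x) ≠ lam (coc s y) := by
  obtain ⟨a, ha⟩ : ∃ a, lam a ≠ 1 := by
    by_contra! h
    exact hlam (by ext a; simpa using h a)
  obtain ⟨S, hS, hne⟩ : ∃ S : Matrix (Fin n) (Fin n) K, Sᵀ = S ∧
      (S *ᵥ x) ⬝ᵥ x ≠ (S *ᵥ y) ⬝ᵥ y := by
    by_contra! h
    rcases eq_or_eq_neg_of_forall_symmetric h with h | h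
    · exact h1 h
    · exact h2 h
  have hd := sub_ne_zero.2 hne
  set d := (S *ᵥ x) ⬝ᵥ x - (S *ᵥ y) ⬝ᵥ y with hd'
  have hS' : ((a / d) • S)ᵀ = (a / d) • S := by rw [Matrix.transpose_smul, hS]
  -- The factor `a / d` makes the two quadratic values differ by exactly `a`, where `λ a ≠ 1`.
  refine ⟨symSp _ hS', symSp_mem_SpPt _ hS', actN_symSp _ hS', fun h => ha ?_⟩
  rw [coc_symSp, coc_symSp, Matrix.smul_mulVec, Matrix.smul_mulVec, smul_dotProduct,
    smul_dotProduct] at h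
  have h3 : a = (a / d) • ((S *ᵥ x) ⬝ᵥ x) - (a / d) • ((S *ᵥ y) ⬝ᵥ y) := by
    rw [← smul_sub, ← hd', smul_eq_mul, div_mul_cancel₀ _ hd]
  have h4 := lam.map_add_eq_mul a ((a / d) • ((S *ᵥ y) ⬝ᵥ y))
  nth_rewrite 1 [h3] at h4
  rw [sub_add_cancel, h] at h4
  exact (mul_eq_right₀ (addChar_ne_zero lam _)).1 h4.symm

end Symmetric

section Main

variable [Finite K] {F : Type v} [Field F]

lemma EPlus_ne_zero {x : Fin n → K} (hx : x ≠ 0) : EPlus K F x ≠ 0 := by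
  intro h
  have h1 := DFunLike.congr_fun h x
  unfold EPlus at h1
  split_ifs at h1 with h2
  · simp at h1
  · have : -x ≠ x := fun h3 => h2 ((neg_eq_self_iff_of_ne_zero hx).1 h3.symm)
    simp [this] at h1

lemma EPlus_neg (x : Fin n → K) : EPlus K F (-x) = EPlus K F x := by
  by_cases hx : x = 0
  · rw [hx, neg_zero]
  unfold EPlus
  split_ifs with h
  · rw [← (neg_eq_self_iff_of_ne_zero hx).2 h]
  · rw [neg_neg, add_comm]

lemma EPlus_mem (lam : AddChar K F) {x : Fin n → K} (hx : x ≠ 0) :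
    EPlus K F x ∈ (XPlus n lam).toSubmodule := Submodule.subset_span ⟨x, hx, rfl⟩

variable [NeZero n]

lemma exists_actN_eq_of_ne_zero {x y : Fin n → K} (hx : x ≠ 0) (hy : y ≠ 0) :
    ∃ g ∈ SpM n K, actN g x = y := by
  obtain ⟨g, hg, rfl⟩ := exists_actN_eq hx
  obtain ⟨h, hh, rfl⟩ := exists_actN_eq hy
  exact ⟨h * g⁻¹, mul_mem hh (inv_mem hg), by
    rw [← actN_mul (mul_mem hh (inv_mem hg)), inv_mul_cancel_right]⟩

/-- The vectors `E⁺_x`, for `x` in a set of representatives modulo sign. -/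
def weilFamily (lam : AddChar K F) (x : {x : Fin n → K // IsPositive x}) :
    (XPlus n lam).toSubmodule := ⟨EPlus K F x.1, EPlus_mem lam x.2.1⟩

theorem isMonomialFamily_weilFamily {lam : AddChar K F} (hlam : lam ≠ 1) :
    IsMonomialFamily (XPlus n lam).toRepresentation (weilFamily lam) where
  nonempty := by
    rcases isPositive_or_neg (vLast_ne_zero (n := n) (K := K)) with h | h
    exacts [⟨⟨_, h⟩⟩, ⟨⟨_, h⟩⟩]
  span_eq := by
    apply Submodule.map_injective_of_injective (XPlus n lam).toSubmodule.injective_subtype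
    rw [Submodule.map_span, Submodule.map_subtype_top, ← Set.range_comp]
    apply le_antisymm
    · rw [Submodule.span_le]
      rintro _ ⟨x, rfl⟩
      exact EPlus_mem lam x.2.1
    · refine Submodule.span_le.2 ?_
      rintro _ ⟨x, hx, rfl⟩
      rcases isPositive_or_neg hx with h | h
      · exact Submodule.subset_span ⟨⟨x, h⟩, rfl⟩
      · rw [← EPlus_neg]
        exact Submodule.subset_span ⟨⟨-x, h⟩, rfl⟩
  ne_zero x h := EPlus_ne_zero (F := F) x.2.1 (congrArg Subtype.val h)
  separated x y hxy := by
    obtain ⟨s, hs, h1, h2⟩ := exists_separating hlam (x := x.1) (y := y.1)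
      (fun h => hxy (Subtype.ext h)) fun h => hxy (Subtype.ext (by
        have h3 := y.2.eq_neg (h ▸ x.2)
        rw [h, ← h3]))
    refine ⟨⟨s, SpPt_le_SpM hs⟩, fun z => lam (coc s z.1), fun z => Subtype.ext ?_, h2⟩
    change XRep lam _ (EPlus K F z.1) = lam (coc s z.1) • EPlus K F z.1
    rw [XRep_EPlus]
    dsimp only
    rw [h1]
    rw [coc, h1]
  transitive x y := by
    obtain ⟨g, hg, h⟩ := exists_actN_eq_of_ne_zero x.2.1 y.2.1
    refine ⟨⟨g, hg⟩, _, addChar_ne_zero lam (coc g x.1), Subtype.ext ?_⟩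
    change XRep lam _ (EPlus K F x.1) = lam (coc g x.1) • EPlus K F y.1
    rw [XRep_EPlus, ← h]
    rfl

/-! ### The isomorphism between `X⁺` and `L` -/

lemma leftMul_apply (g : SpM n K) (y : F[Sp n K]) :
    leftMul n K F g y = MonoidAlgebra.of F (Sp n K) g.1 * y := rfl

/-- `L` as a module for `Sp_M`. -/
def LRep (lam : AddChar K F) (hq : ((Nat.card K : ℕ) : F) + 1 = 0) {Tq : Set Kˣ}
    (hTq : IsTransversal Tq) : Subrepresentation (leftMul n K F) where
  toSubmodule := LMod n lam Tq
  apply_mem_toSubmodule g y hy := by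
    rw [LMod_eq_span lam hq hTq] at hy ⊢
    induction hy using Submodule.span_induction with
    | mem y hy =>
      obtain ⟨h, hh, rfl⟩ := hy
      rw [leftMul_apply, of_mul_translate lam g.2]
      exact Submodule.smul_mem _ _ (Submodule.subset_span ⟨_, mul_mem g.2 hh, rfl⟩)
    | zero => rw [map_zero]; exact Submodule.zero_mem _
    | add y z _ _ hy hz => rw [map_add]; exact Submodule.add_mem _ hy hz
    | smul c y _ hy => rw [map_smul]; exact Submodule.smul_mem _ _ hy

lemma vecTranslate_mem (lam : AddChar K F) (hq : ((Nat.card K : ℕ) : F) + 1 = 0) {Tq : Set Kˣ}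
    (hTq : IsTransversal Tq) {x : Fin n → K} (hx : x ≠ 0) :
    vecTranslate lam x ∈ LMod n lam Tq := by
  obtain ⟨g, hg, h⟩ := exists_actN_eq hx
  rw [LMod_eq_span lam hq hTq, vecTranslate_eq lam hq hg (Or.inl h)]
  exact Submodule.subset_span ⟨g, hg, rfl⟩

lemma weilMap_XRep (lam : AddChar K F) (hq : ((Nat.card K : ℕ) : F) + 1 = 0) (g : SpM n K)
    {y : (Fin n → K) →₀ F} (hy : y ∈ (XPlus n lam).toSubmodule) :
    weilMap lam (XRep lam g y) = leftMul n K F g (weilMap lam y) := by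
  induction hy using Submodule.span_induction with
  | mem y hy =>
    obtain ⟨x, hx, rfl⟩ := hy
    rw [XRep_EPlus, map_smul, weilMap_EPlus lam hq hx, weilMap_EPlus lam hq (actN_ne_zero g hx),
      leftMul_apply, of_mul_vecTranslate lam hq g hx]
    rfl
  | zero => simp only [map_zero]
  | add y z _ _ hy hz => simp only [map_add, hy, hz]
  | smul c y _ hy => simp only [map_smul, hy]

lemma weilMap_mem (lam : AddChar K F) (hq : ((Nat.card K : ℕ) : F) + 1 = 0) {Tq : Set Kˣ}
    (hTq : IsTransversal Tq) {y : (Fin n → K) →₀ F} (hy : y ∈ (XPlus n lam).toSubmodule) :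
    weilMap lam y ∈ LMod n lam Tq := by
  induction hy using Submodule.span_induction with
  | mem y hy =>
    obtain ⟨x, hx, rfl⟩ := hy
    rw [weilMap_EPlus lam hq hx]
    exact vecTranslate_mem lam hq hTq hx
  | zero => rw [map_zero]; exact Submodule.zero_mem _
  | add y z _ _ hy hz => rw [map_add]; exact Submodule.add_mem _ hy hz
  | smul c y _ hy => rw [map_smul]; exact Submodule.smul_mem _ _ hy

/-- The homomorphism `X⁺ → L`. -/
def weilHom (lam : AddChar K F) (hq : ((Nat.card K : ℕ) : F) + 1 = 0) {Tq : Set Kˣ}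
    (hTq : IsTransversal Tq) :
    (XPlus n lam).toRepresentation.IntertwiningMap (LRep lam hq hTq).toRepresentation where
  toLinearMap := (weilMap lam).restrict fun _ hy => weilMap_mem lam hq hTq hy
  isIntertwining' g := LinearMap.ext fun y => Subtype.ext (weilMap_XRep lam hq g y.2)

/-- Injectivity costs no dimension count: `X⁺` is irreducible and `E⁺_{v_n}` goes to a nonzero
translate. Surjectivity holds because every generator of `L` is an image. -/
theorem weilHom_bijective {lam : AddChar K F} (hlam : lam ≠ 1)
    (hq : ((Nat.card K : ℕ) : F) + 1 = 0) {Tq : Set Kˣ} (hTq : IsTransversal Tq) :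
    Function.Bijective (weilHom (n := n) lam hq hTq) := by
  have := (isMonomialFamily_weilFamily (n := n) hlam).isIrreducible
  constructor
  · refine (Representation.IsIrreducible.injective_or_eq_zero
      (V := (XPlus n lam).toSubmodule) (W := (LRep (n := n) lam hq hTq).toSubmodule)
      (weilHom lam hq hTq)).resolve_right fun h => ?_
    have h1 : weilHom (n := n) lam hq hTq ⟨_, EPlus_mem lam vLast_ne_zero⟩ = 0 := by rw [h]; rfl
    have h2 : weilMap lam (EPlus K F (vLast n K)) = 0 := congrArg Subtype.val h1
    rw [weilMap_EPlus lam hq vLast_ne_zero,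
      vecTranslate_eq lam hq (one_mem _) (Or.inl (actN_one _))] at h2
    exact translate_ne_zero lam _ h2
  · have h : (XPlus n lam).toSubmodule.map (weilMap lam) = LMod n lam Tq := by
      apply le_antisymm
      · rintro _ ⟨y, hy, rfl⟩
        exact weilMap_mem lam hq hTq hy
      · rw [LMod_eq_span lam hq hTq, Submodule.span_le]
        rintro _ ⟨g, hg, rfl⟩
        have hx : actN g (vLast n K) ≠ 0 := actN_ne_zero ⟨g, hg⟩ vLast_ne_zero
        exact ⟨_, EPlus_mem lam hx, by
          rw [weilMap_EPlus lam hq hx, vecTranslate_eq lam hq hg (Or.inl rfl)]⟩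
    rintro ⟨z, hz⟩
    have hz' : z ∈ (XPlus n lam).toSubmodule.map (weilMap lam) := h ▸ hz
    obtain ⟨y, hy, rfl⟩ := hz'
    exact ⟨⟨y, hy⟩, rfl⟩

end Main

end

end SymplecticSteinberg

theorem mainTheorem7 {K : Type*} [Field K] [Finite K] (n : ℕ) [NeZero n]
    {F : Type*} [Field F] (l : ℕ) [CharP F l] (hl : l ∣ Nat.card K + 1)
    (lam : AddChar K F) (hlam : lam ≠ 1) (Tq : Set Kˣ) (hTq : SymplecticSteinberg.IsTransversal Tq) :
    SymplecticSteinberg.LMod n lam Tq ≤ SymplecticSteinberg.steinberg n K F ∧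
      ∃ L : Subrepresentation (SymplecticSteinberg.leftMul n K F),
        L.toSubmodule = SymplecticSteinberg.LMod n lam Tq ∧
        SymplecticSteinberg.IsAbsolutelyIrreducible L.toRepresentation ∧
        Nonempty (L.toRepresentation.Equiv (SymplecticSteinberg.XPlus n lam).toRepresentation) := by
  have hq : ((Nat.card K : ℕ) : F) + 1 = 0 := by
    exact_mod_cast (CharP.cast_eq_zero_iff F l _).2 hl
  let e := Representation.IntertwiningMap.ofBijective
    (SymplecticSteinberg.weilHom (n := n) lam hq hTq)
    (SymplecticSteinberg.weilHom_bijective hlam hq hTq)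
  exact ⟨SymplecticSteinberg.LMod_le_steinberg lam Tq, SymplecticSteinberg.LRep lam hq hTq, rfl,
    -- Absolute irreducibility of `L` comes from carrying the monomial family of `X⁺` along the
    -- isomorphism.
    ((SymplecticSteinberg.isMonomialFamily_weilFamily hlam).map e).isAbsolutelyIrreducible,
    ⟨e.symm⟩⟩
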